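/- Let $\kappa,\tau\in\mathbb R$ with $\kappa-4\tau^2\neq 0$, and let $\mathbb E(\kappa,\tau)$ be the oriented simply connected homogeneous Riemannian $3$-manifold that fibers over the simply connected surface $\mathbb M^2(\kappa)$ of constant curvature $\kappa$ with bundle curvature $\tau$ and unit vertical Killing field $\xi$, so that $\overline\nabla_X\xi=\tau\,X\wedge\xi$, where $\overline\nabla$ is the Levi-Civita connection and $\wedge$ the vector product. (For $\tau=0$ this is $\mathbb M^2(\kappa)\times\mathbb R$; for $\tau\ne0$ it is a Berger sphere, the Heisenberg space or the universal cover of $\mathrm{PSL}(2,\mathbb R)$ according to $\kappa>0$, $\kappa=0$, $\kappa<0$.) For an oriented immersed surface $\Sigma$ in $\mathbb E(\kappa,\tau)$ with unit normal $N$ and constant mean curvature $H$ (an $H$-surface) such that $H^2+\tau^2\neq0$, put $AX=-\overline\nabla_XN$, $JX=N\wedge X$, $\mathbf T=\xi-\langle N,\xi\rangle N$, choose $\theta\in\mathbb R$ with $e^{2i\theta}=\frac{H-i\tau}{\sqrt{H^2+\tau^2}}$, and let $\mathbf T_\theta=\cos\theta\,\mathbf T+\sin\theta\,J\mathbf T$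 and $\alpha=\frac{\kappa-4\tau^2}{2\sqrt{H^2+\tau^2}}$. The Abresch-Rosenberg shape operator of $\Sigma$ is $$S_{AR}X=\begin{cases}2H\,AX-\kappa\langle X,\mathbf T\rangle\mathbf T+\frac{\kappa}{2}|\mathbf T|^2X-2H^2X,&\tau=0,\\[2pt] AX-\alpha\langle\mathbf T_\theta,X\rangle\mathbf T_\theta+\frac{\alpha|\mathbf T|^2}{2}X-HX,&\tau\neq0.\end{cases}$$ A regular curve $\Gamma$ parametrized by $\gamma:(-\epsilon,\epsilon)\to\Sigma$ is an AR-line of curvature of $\Sigma$ if there is a smooth function $\lambda:(-\epsilon,\epsilon)\to\mathbb R$ with $S_{AR}(\gamma'(t))=\lambda(t)\gamma'(t)$ for all $t$. **Lemma.** For $i=1,2$ let $\Sigma_i$ be an $H_i$-surface in $\mathbb E(\kappa,\tau)$ with $H_i^2+\tau^2\neq0$, and denote its objects as above by $N_i,J_i,\theta_i,\mathbf T^i_{\theta_i}$. Let $\Gamma\subset\Sigma_1\cap\Sigma_2$ be a regular curve along which $\Sigma_1$ and $\Sigma_2$ intersect transversally. Assume that along $\Gamma$: (a) $\langle N_1,N_2\rangle$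 is constant, and (b) $\sqrt{H_1^2+\tau^2}\,\langle\mathbf T^2_{\theta_2},N_1\rangle\langle J_2\mathbf T^2_{\theta_2},N_1\rangle=\sqrt{H_2^2+\tau^2}\,\langle\mathbf T^1_{\theta_1},N_2\rangle\langle J_1\mathbf T^1_{\theta_1},N_2\rangle$. Then $\Gamma$ is an AR-line of curvature of $\Sigma_1$ if and only if it is an AR-line of curvature of $\Sigma_2$. -/

import Mathlib

open scoped Manifold ContDiff

noncomputable section

namespace EKT

/-- Coordinate space `ℝ⁴`. Every space `𝔼(κ, τ)` is realised below as an oriented hypersurface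
`{F = 0}` of a domain of `ℝ⁴` on which a Riemannian metric `g` is given by its Gram matrix. Its
Riemannian metric is the restriction of `g` to the tangent spaces. -/
abbrev Coord : Type := Fin 4 → ℝ

/-! ### Oriented hypersurfaces of a Riemannian domain of `ℝ⁴` -/

section Ambient

variable (G : Coord → Matrix (Fin 4) (Fin 4) ℝ) (F : Coord → ℝ)

/-- The inner product `g_x(u, v)` with Gram matrix `G x`. -/
def inn (x u v : Coord) : ℝ := u ⬝ᵥ ((G x).mulVec v)

/-- The partial derivative `∂_i g_{jl}` at `x`. -/
def dGram (x : Coord) (i j l : Fin 4) : ℝ :=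
  fderiv ℝ (fun y => G y j l) x (Pi.single i 1)

/-- The Christoffel term `Γ_x(u, v)`, with components
`½ ∑ g^{kl} (∂_i g_{jl} + ∂_j g_{il} - ∂_l g_{ij}) u^i v^j`. -/
def christoffel (x u v : Coord) : Coord :=
  (1 / 2 : ℝ) • (G x)⁻¹.mulVec fun l =>
    ∑ i, ∑ j, (dGram G x i j l + dGram G x j i l - dGram G x l i j) * u i * v j

/-- The tangent space at `x` of the hypersurface `{F = 0}`. -/
def tangent (x : Coord) : Submodule ℝ Coord := LinearMap.ker (fderiv ℝ F x).toLinearMap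

/-- The gradient of `F` with respect to `g`. -/
def grad (x : Coord) : Coord := (G x)⁻¹.mulVec fun k => fderiv ℝ F x (Pi.single k 1)

/-- The `g`-unit normal `ν = grad F / |grad F|` of the hypersurface. -/
def conormal (x : Coord) : Coord :=
  (√(inn G x (grad G F x) (grad G F x)))⁻¹ • grad G F x

/-- The `g`-orthogonal projection onto the tangent space of the hypersurface. -/
def proj (x u : Coord) : Coord := u - inn G x u (conormal G F x) • conormal G F x

/-- The wedge product `u ∧ v` of two tangent vectors of the hypersurface: the tangent vector with
`g(u ∧ v, w) = ω(u, v, w)` for all `w`, where `ω(u, v, w) = √(det g) · det(u, v, w, ν)` is the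
Riemannian volume form of the hypersurface, oriented by `ν`. -/
def wedge (x u v : Coord) : Coord :=
  (G x)⁻¹.mulVec fun k =>
    √(G x).det * Matrix.det (Matrix.of ![u, v, Pi.single k 1, conormal G F x])

end Ambient

/-! ### The spaces `𝔼(κ, τ)` -/

/-- The vector `i x` for `x ∈ ℝ⁴ = ℂ²`; on the unit sphere it spans the Hopf fibres. -/
def hopf (x : Coord) : Coord := ![-x 1, x 0, -x 3, x 2]

/-- The conformal factor `λ = 1 / (1 + κ (x² + y²) / 4)` of the curvature `κ` metric. -/
def conf (κ : ℝ) (x : Coord) : ℝ := (1 + κ / 4 * (x 0 ^ 2 + x 1 ^ 2))⁻¹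

/-- The connection form `dz + τ λ (y dx - x dy)` of the bundle `𝔼(κ, τ) → 𝕄²(κ)`, for `κ ≤ 0`. -/
def connForm (κ τ : ℝ) (x : Coord) : Coord :=
  ![τ * conf κ x * x 1, -(τ * conf κ x * x 0), 1, 0]

/-- The underlying set of `𝔼(κ, τ)`:
* `κ ≤ 0`: `{(x, y, z) : 1 + κ (x² + y²) / 4 > 0}`, placed in `ℝ³ × {0}`
  (`ℍ²(κ) × ℝ`, the Heisenberg space, the universal cover of `PSL(2, ℝ)`);
* `κ > 0`, `τ = 0`: `𝕊²(κ) × ℝ`, where `𝕊²(κ) ⊂ ℝ³` is the sphere of radius `1 / √κ`;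
* `κ > 0`, `τ ≠ 0`: the unit sphere `𝕊³ ⊂ ℂ²` (Berger spheres). -/
def carrier (κ τ : ℝ) : Set Coord :=
  if κ ≤ 0 then {x | 0 < 1 + κ / 4 * (x 0 ^ 2 + x 1 ^ 2) ∧ x 3 = 0}
  else if τ = 0 then {x | x 0 ^ 2 + x 1 ^ 2 + x 2 ^ 2 = 1 / κ}
  else {x | x 0 ^ 2 + x 1 ^ 2 + x 2 ^ 2 + x 3 ^ 2 = 1}

/-- The function whose zero set (in the domain of the metric) is `𝔼(κ, τ)`. The normal
`grad F / |grad F|` orients `𝔼(κ, τ)`; for Berger spheres the sign of `τ` selects the orientation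
for which `∇_X ξ = τ X ∧ ξ`. -/
def defFun (κ τ : ℝ) (x : Coord) : ℝ :=
  if κ ≤ 0 then x 3
  else if τ = 0 then x 0 ^ 2 + x 1 ^ 2 + x 2 ^ 2 - 1 / κ
  else τ * (x 0 ^ 2 + x 1 ^ 2 + x 2 ^ 2 + x 3 ^ 2 - 1)

/-- The Gram matrix of the metric of `𝔼(κ, τ)`, extended to a neighbourhood in `ℝ⁴`:
* `κ ≤ 0`: `λ² (dx² + dy²) + (dz + τ λ (y dx - x dy))²`, plus the square of the last coordinate;
* `κ > 0`, `τ = 0`: the Euclidean metric, which induces the product metric on `𝕊²(κ) × ℝ`;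
* `κ > 0`, `τ ≠ 0`: the Berger metric
  `(4 / κ) (⟨X, Y⟩ + (4 τ² / κ - 1) ⟨X, i x⟩ ⟨Y, i x⟩)`. -/
def gram (κ τ : ℝ) (x : Coord) : Matrix (Fin 4) (Fin 4) ℝ :=
  if κ ≤ 0 then
    Matrix.diagonal ![conf κ x ^ 2, conf κ x ^ 2, 0, 1]
      + Matrix.vecMulVec (connForm κ τ x) (connForm κ τ x)
  else if τ = 0 then 1
  else (4 / κ) • (1 + (4 * τ ^ 2 / κ - 1) • Matrix.vecMulVec (hopf x) (hopf x))

/-- The vertical unit Killing field `ξ`. -/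
def xi (κ τ : ℝ) (x : Coord) : Coord :=
  if κ ≤ 0 then ![0, 0, 1, 0]
  else if τ = 0 then ![0, 0, 0, 1]
  else (κ / (4 * τ)) • hopf x

/-- The metric `⟨u, v⟩` of `𝔼(κ, τ)` at `x`. -/
def metric (κ τ : ℝ) (x u v : Coord) : ℝ := inn (gram κ τ) x u v

/-- The tangent space of `𝔼(κ, τ)` at `x`. -/
def tangentE (κ τ : ℝ) (x : Coord) : Submodule ℝ Coord := tangent (defFun κ τ) x

/-- The wedge product of `𝔼(κ, τ)` at `x`. -/
def wedgeE (κ τ : ℝ) (x u v : Coord) : Coord := wedge (gram κ τ) (defFun κ τ) x u v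

/-- The Levi-Civita derivative of `𝔼(κ, τ)`, at a point `x`, of a vector field `V` along a map into
`𝔼(κ, τ)`: here `u` is the velocity of the map, `v` is the value of `V`, and `dv` is the derivative
of the components of `V`. It is the tangential part of the Levi-Civita derivative
`dv + Γ(u, v)` of the metric on the domain of `ℝ⁴`. -/
def covDeriv (κ τ : ℝ) (x u v dv : Coord) : Coord :=
  proj (gram κ τ) (defFun κ τ) x (dv + christoffel (gram κ τ) x u v)

/-! ### Surfaces in `𝔼(κ, τ)` -/

section Surface

variable {M : Type*} [TopologicalSpace M] (I : ModelWithCorners ℝ (EuclideanSpace ℝ (Fin 2)) M)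
  {S : Type*} [TopologicalSpace S] [ChartedSpace M S]

/-- The differential at `p` of a map from the surface `S` into `ℝ⁴`. -/
def diff (f : S → Coord) (p : S) : EuclideanSpace ℝ (Fin 2) →L[ℝ] Coord :=
  mfderiv I 𝓘(ℝ, Coord) f p

/-- `φ : S → 𝔼(κ, τ)` is a smooth immersion and `N` a smooth unit normal field along `φ`. -/
structure IsOrientedImmersion (κ τ : ℝ) (φ N : S → Coord) : Prop where
  smooth : ContMDiff I 𝓘(ℝ, Coord) ∞ φ
  mem : ∀ p, φ p ∈ carrier κ τ
  immersion : ∀ p, Function.Injective (diff I φ p)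
  normal_smooth : ContMDiff I 𝓘(ℝ, Coord) ∞ N
  normal_mem : ∀ p, N p ∈ tangentE κ τ (φ p)
  normal_unit : ∀ p, metric κ τ (φ p) (N p) (N p) = 1
  normal_orth : ∀ p X, metric κ τ (φ p) (diff I φ p X) (N p) = 0

/-- The shape operator `A X = -∇_X N`. Tangent vectors of the surface are identified with their
images under `dφ`, so the value is a vector tangent to `𝔼(κ, τ)` at `φ p`. -/
def shape (κ τ : ℝ) (φ N : S → Coord) (p : S) (X : EuclideanSpace ℝ (Fin 2)) : Coord :=
  -covDeriv κ τ (φ p) (diff I φ p X) (N p) (diff I N p X)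

/-- `φ` is an `H`-surface with unit normal `N`: the mean curvature, i.e. half of the trace of the
shape operator in any orthonormal basis of the tangent plane, is the constant `H`. -/
structure IsHSurface (κ τ : ℝ) (φ N : S → Coord) (H : ℝ) : Prop
    extends IsOrientedImmersion I κ τ φ N where
  mean_curvature : ∀ (p : S) (X Y : EuclideanSpace ℝ (Fin 2)),
    metric κ τ (φ p) (diff I φ p X) (diff I φ p X) = 1 →
    metric κ τ (φ p) (diff I φ p Y) (diff I φ p Y) = 1 →
    metric κ τ (φ p) (diff I φ p X) (diff I φ p Y) = 0 →
    (metric κ τ (φ p) (shape I κ τ φ N p X) (diff I φ p X)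
      + metric κ τ (φ p) (shape I κ τ φ N p Y) (diff I φ p Y)) / 2 = H

/-- `J u = N ∧ u`, the rotation by `π / 2` in the tangent plane. -/
def rot (κ τ : ℝ) (φ N : S → Coord) (p : S) (u : Coord) : Coord := wedgeE κ τ (φ p) (N p) u

/-- `T = ξ - ⟨N, ξ⟩ N`, the tangential part of the vertical field. -/
def vertTan (κ τ : ℝ) (φ N : S → Coord) (p : S) : Coord :=
  xi κ τ (φ p) - metric κ τ (φ p) (N p) (xi κ τ (φ p)) • N p

/-- `T_θ = cos θ T + sin θ J T`. -/
def vertTanRot (κ τ : ℝ) (φ N : S → Coord) (θ : ℝ) (p : S) : Coord :=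
  Real.cos θ • vertTan κ τ φ N p + Real.sin θ • rot κ τ φ N p (vertTan κ τ φ N p)

/-- `θ` satisfies `e^{2iθ} = (H - iτ) / √(H² + τ²)`. -/
def IsPhase (H τ θ : ℝ) : Prop :=
  Complex.exp (2 * Complex.I * θ) = (H - Complex.I * τ) / ((√(H ^ 2 + τ ^ 2) : ℝ) : ℂ)

/-- The Abresch-Rosenberg shape operator of an `H`-surface with phase `θ`:
`2H A X - κ ⟨X, T⟩ T + (κ / 2) |T|² X - 2H² X` if `τ = 0`, and
`A X - α ⟨T_θ, X⟩ T_θ + (α |T|² / 2) X - H X`, with `α = (κ - 4τ²) / (2 √(H² + τ²))`, if `τ ≠ 0`. -/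
def shapeAR (κ τ : ℝ) (φ N : S → Coord) (H θ : ℝ) (p : S) (X : EuclideanSpace ℝ (Fin 2)) :
    Coord :=
  let g := metric κ τ (φ p)
  let A := shape I κ τ φ N p X
  let x := diff I φ p X
  let T := vertTan κ τ φ N p
  let Tθ := vertTanRot κ τ φ N θ p
  let α := (κ - 4 * τ ^ 2) / (2 * √(H ^ 2 + τ ^ 2))
  if τ = 0 then
    (2 * H) • A - (κ * g x T) • T + (κ / 2 * g T T) • x - (2 * H ^ 2) • x
  else
    A - (α * g Tθ x) • Tθ + (α * g T T / 2) • x - H • x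

/-- The velocity `γ'(t)` of a curve in the surface. -/
def velocity (γ : ℝ → S) (t : ℝ) : EuclideanSpace ℝ (Fin 2) :=
  (mfderiv 𝓘(ℝ, ℝ) I γ t : ℝ →L[ℝ] EuclideanSpace ℝ (Fin 2)) 1

/-- `γ : (-ε, ε) → S` is an Abresch-Rosenberg line of curvature: `S_AR(γ') = l γ'` for a smooth
function `l` on `(-ε, ε)`. -/
def IsARLine (κ τ : ℝ) (φ N : S → Coord) (H θ ε : ℝ) (γ : ℝ → S) : Prop :=
  ∃ l : ℝ → ℝ, ContDiffOn ℝ ∞ l (Set.Ioo (-ε) ε) ∧ ∀ t ∈ Set.Ioo (-ε) ε,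
    shapeAR I κ τ φ N H θ (γ t) (velocity I γ t) = l t • diff I φ (γ t) (velocity I γ t)

end Surface

end EKT

end

/-!
Write `x = φ₁ ∘ γ₁ = φ₂ ∘ γ₂` for the common curve in `𝔼(κ, τ)`, `u = x'`, and `c = ⟨N₁, N₂⟩`. Only
the values of `u`, `N₁`, `N₂` and their derivatives along the curve matter, so the argument takes
place on a curve carrying two unit normal fields (`EKT.IsNormalAlong`).

The operator `S` maps `u` into the tangent plane of the surface, of which `u`, `J u` is an
orthogonal basis. Hence the curve is an Abresch-Rosenberg line of curvature iff `⟨S u, J u⟩ = 0`,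
the eigenvalue `⟨S u, u⟩ / ⟨u, u⟩` being smooth (`EKT.IsNormalAlong.exists_eigenvalue_iff`). Up to a
nonzero factor, `⟨S u, J u⟩` is `⟨A u, J u⟩ - α ⟨T_θ, u⟩ ⟨T_θ, J u⟩`, both for `τ = 0` and for
`τ ≠ 0` (`EKT.IsNormalAlong.inn_shapeARAlong_rot`). Both terms agree for the two surfaces:

* Transversality gives `c² ≠ 1`, and `J₁ u` is a multiple of `N₂ - c N₁`, `J₂ u` of `N₁ - c N₂`,
  with `⟨J₁ u, N₂⟩ = -⟨J₂ u, N₁⟩ ≠ 0`. Differentiating `⟨N₁, N₂⟩ = c` gives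
  `⟨A₁ u, N₂⟩ + ⟨A₂ u, N₁⟩ = 0` (`EKT.IsNormalAlong.inn_shapeAlong_add`, Joachimsthal's
  argument), and therefore `⟨A₁ u, J₁ u⟩ = ⟨A₂ u, J₂ u⟩`.
* The same decomposition yields `(1 - c²) ⟨T_θ, u⟩ ⟨T_θ, J u⟩ = |u|² ⟨T_θ, N⟩ ⟨J T_θ, N⟩`, where
  `N` is the normal of the other surface, so that the hypothesis on these products is the equality of the
  terms with `α₁` and `α₂`.

All identities involving `J` are instances of Gram's identity for the volume form
(`EKT.IsRegularPoint.vol_mul_vol`). The Levi-Civita derivative of the coordinate model is compatible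
with the metric along curves (`EKT.hasDerivAt_inn`), because the model is a hypersurface of a
Riemannian domain in all three cases (`EKT.isRegularPoint`).
-/

noncomputable section

namespace EKT

/-! ### Metric, wedge product and volume form of a hypersurface -/

section Ambient

variable {G : Coord → Matrix (Fin 4) (Fin 4) ℝ} {F : Coord → ℝ} {x : Coord}

lemma inn_add_left (u v w : Coord) : inn G x (u + v) w = inn G x u w + inn G x v w := by
  simp [inn, add_dotProduct]

lemma inn_smul_left (a : ℝ) (u v : Coord) : inn G x (a • u) v = a * inn G x u v := by
  simp [inn]

lemma inn_smul_right (a : ℝ) (u v : Coord) : inn G x u (a • v) = a * inn G x u v := by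
  simp [inn, Matrix.mulVec_smul]

lemma inn_neg_left (u v : Coord) : inn G x (-u) v = -inn G x u v := by
  simp [inn]

lemma inn_sub_left (u v w : Coord) : inn G x (u - v) w = inn G x u w - inn G x v w := by
  simp [inn, sub_dotProduct]

lemma inn_sub_right (u v w : Coord) : inn G x u (v - w) = inn G x u v - inn G x u w := by
  simp [inn, Matrix.mulVec_sub, dotProduct_sub]

lemma inn_comm (hG : (G x).IsSymm) (u v : Coord) : inn G x u v = inn G x v u := by
  rw [inn, inn, Matrix.dotProduct_mulVec, ← Matrix.mulVec_transpose, hG.eq, dotProduct_comm]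

lemma inn_eq_sum (u v : Coord) : inn G x u v = ∑ j, ∑ l, G x j l * v l * u j := by
  simp only [inn, dotProduct, Matrix.mulVec, Finset.mul_sum]
  exact Finset.sum_congr rfl fun _ _ => Finset.sum_congr rfl fun _ _ => by ring

/-- `x` is a point near which `g` is a smooth Riemannian metric and `{F = 0}` is a smooth
hypersurface. Symmetry of the Gram matrix is required everywhere, as it is differentiated. -/
structure IsRegularPoint (G : Coord → Matrix (Fin 4) (Fin 4) ℝ) (F : Coord → ℝ) (x : Coord) :
    Prop where
  symm : ∀ y, (G y).IsSymm
  pos : ∀ v : Coord, v ≠ 0 → 0 < inn G x v v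
  smooth_gram : ∀ i j, ContDiffAt ℝ ∞ (fun y => G y i j) x
  smooth_fun : ContDiffAt ℝ ∞ F x
  fderiv_ne : fderiv ℝ F x ≠ 0

namespace IsRegularPoint

lemma det_pos (h : IsRegularPoint G F x) : 0 < (G x).det := by
  have : (G x).PosDef := by
    refine Matrix.PosDef.of_dotProduct_mulVec_pos ?_ fun {v} hv => ?_
    · have := h.symm x
      rw [Matrix.IsHermitian, Matrix.conjTranspose_eq_transpose_of_trivial, this.eq]
    · simpa [inn] using h.pos v hv
  exact this.det_pos

lemma mul_inv (h : IsRegularPoint G F x) : G x * (G x)⁻¹ = 1 :=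
  Matrix.mul_nonsing_inv _ h.det_pos.ne'.isUnit

/-- Raising an index: `g(G⁻¹ k, w) = k · w`. -/
lemma inn_inv_mulVec (h : IsRegularPoint G F x) (k w : Coord) :
    inn G x ((G x)⁻¹.mulVec k) w = k ⬝ᵥ w := by
  rw [inn_comm (h.symm x), inn, Matrix.mulVec_mulVec, h.mul_inv, Matrix.one_mulVec,
    dotProduct_comm]

lemma inn_grad (h : IsRegularPoint G F x) (w : Coord) :
    inn G x (grad G F x) w = fderiv ℝ F x w := by
  rw [grad, h.inn_inv_mulVec]
  conv_rhs => rw [← Finset.univ_sum_single w, map_sum]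
  refine Finset.sum_congr rfl fun k _ => ?_
  rw [mul_comm, ← smul_eq_mul, ← map_smul, ← Pi.single_smul, smul_eq_mul, mul_one]

lemma grad_ne_zero (h : IsRegularPoint G F x) : grad G F x ≠ 0 := by
  intro h0
  refine h.fderiv_ne (ContinuousLinearMap.ext fun w => ?_)
  rw [← h.inn_grad, h0]
  simp [inn]

lemma inn_conormal_self (h : IsRegularPoint G F x) :
    inn G x (conormal G F x) (conormal G F x) = 1 := by
  have hp := h.pos _ h.grad_ne_zero
  rw [conormal, inn_smul_left, inn_smul_right, ← mul_assoc, ← _root_.mul_inv,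
    Real.mul_self_sqrt hp.le, inv_mul_cancel₀ hp.ne']

lemma inn_conormal_eq_zero_iff (h : IsRegularPoint G F x) (w : Coord) :
    inn G x (conormal G F x) w = 0 ↔ w ∈ tangent F x := by
  have hp := h.pos _ h.grad_ne_zero
  rw [conormal, inn_smul_left, mul_eq_zero, inv_eq_zero, Real.sqrt_eq_zero hp.le, h.inn_grad w]
  simp [hp.ne', tangent]

lemma proj_mem (h : IsRegularPoint G F x) (w : Coord) : proj G F x w ∈ tangent F x := by
  rw [← h.inn_conormal_eq_zero_iff, proj, inn_sub_right, inn_smul_right, h.inn_conormal_self,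
    inn_comm (h.symm x) w]
  ring

lemma inn_proj_left (h : IsRegularPoint G F x) (v : Coord) {w : Coord} (hw : w ∈ tangent F x) :
    inn G x (proj G F x v) w = inn G x v w := by
  rw [proj, inn_sub_left, inn_smul_left, (h.inn_conormal_eq_zero_iff w).2 hw]
  ring

end IsRegularPoint

/-- The Riemannian volume form `ω(a, b, c) = √(det g) · det(a, b, c, ν)` of the hypersurface. -/
def vol (G : Coord → Matrix (Fin 4) (Fin 4) ℝ) (F : Coord → ℝ) (x a b c : Coord) : ℝ :=
  √(G x).det * Matrix.det (Matrix.of ![a, b, c, conormal G F x])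

lemma det_four (M : Matrix (Fin 4) (Fin 4) ℝ) : M.det =
    M 0 0 * (M 1 1 * (M 2 2 * M 3 3 - M 2 3 * M 3 2) - M 1 2 * (M 2 1 * M 3 3 - M 2 3 * M 3 1)
      + M 1 3 * (M 2 1 * M 3 2 - M 2 2 * M 3 1))
    - M 0 1 * (M 1 0 * (M 2 2 * M 3 3 - M 2 3 * M 3 2) - M 1 2 * (M 2 0 * M 3 3 - M 2 3 * M 3 0)
      + M 1 3 * (M 2 0 * M 3 2 - M 2 2 * M 3 0))
    + M 0 2 * (M 1 0 * (M 2 1 * M 3 3 - M 2 3 * M 3 1) - M 1 1 * (M 2 0 * M 3 3 - M 2 3 * M 3 0)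
      + M 1 3 * (M 2 0 * M 3 1 - M 2 1 * M 3 0))
    - M 0 3 * (M 1 0 * (M 2 1 * M 3 2 - M 2 2 * M 3 1) - M 1 1 * (M 2 0 * M 3 2 - M 2 2 * M 3 0)
      + M 1 2 * (M 2 0 * M 3 1 - M 2 1 * M 3 0)) := by
  rw [Matrix.det_succ_row_zero]
  simp [Fin.sum_univ_four, Matrix.det_fin_three, Fin.succAbove]
  ring

lemma vol_eq (a b c : Coord) : vol G F x a b c = √(G x).det *
    (let d := conormal G F x
    a 0 * (b 1 * (c 2 * d 3 - c 3 * d 2) - b 2 * (c 1 * d 3 - c 3 * d 1)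
      + b 3 * (c 1 * d 2 - c 2 * d 1))
    - a 1 * (b 0 * (c 2 * d 3 - c 3 * d 2) - b 2 * (c 0 * d 3 - c 3 * d 0)
      + b 3 * (c 0 * d 2 - c 2 * d 0))
    + a 2 * (b 0 * (c 1 * d 3 - c 3 * d 1) - b 1 * (c 0 * d 3 - c 3 * d 0)
      + b 3 * (c 0 * d 1 - c 1 * d 0))
    - a 3 * (b 0 * (c 1 * d 2 - c 2 * d 1) - b 1 * (c 0 * d 2 - c 2 * d 0)
      + b 2 * (c 0 * d 1 - c 1 * d 0))) := by
  rw [vol, det_four (Matrix.of _)]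
  simp

lemma vol_swap (a b c : Coord) : vol G F x c b a = -vol G F x a b c := by
  simp only [vol_eq]
  ring

lemma vol_swap_right (a b c : Coord) : vol G F x a c b = -vol G F x a b c := by
  simp only [vol_eq]
  ring

namespace IsRegularPoint

lemma inn_wedge (h : IsRegularPoint G F x) (a b c : Coord) :
    inn G x (wedge G F x a b) c = vol G F x a b c := by
  have hk (k : Fin 4) : √(G x).det * Matrix.det (Matrix.of ![a, b, Pi.single k 1,
      conormal G F x]) = vol G F x a b (Pi.single k 1) := rfl
  rw [wedge, h.inn_inv_mulVec, dotProduct, Fin.sum_univ_four]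
  simp only [hk, vol_eq]
  simp
  ring

lemma wedge_mem (h : IsRegularPoint G F x) (a b : Coord) : wedge G F x a b ∈ tangent F x := by
  rw [← h.inn_conormal_eq_zero_iff, inn_comm (h.symm x), h.inn_wedge, vol_eq]
  ring

/-- Gram's identity for the volume form of the hypersurface. -/
lemma vol_mul_vol (h : IsRegularPoint G F x) {a b c a' b' c' : Coord} (ha : a ∈ tangent F x)
    (hb : b ∈ tangent F x) (hc : c ∈ tangent F x) (ha' : a' ∈ tangent F x)
    (hb' : b' ∈ tangent F x) (hc' : c' ∈ tangent F x) :
    vol G F x a b c * vol G F x a' b' c' = Matrix.det !![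
      inn G x a a', inn G x a b', inn G x a c';
      inn G x b a', inn G x b b', inn G x b c';
      inn G x c a', inn G x c b', inn G x c c'] := by
  set ν := conormal G F x
  have key : vol G F x a b c * vol G F x a' b' c' =
      (Matrix.of ![a, b, c, ν] * G x * (Matrix.of ![a', b', c', ν]).transpose).det := by
    rw [Matrix.det_mul, Matrix.det_mul, Matrix.det_transpose, vol, vol]
    have := Real.mul_self_sqrt h.det_pos.le
    linear_combination ((Matrix.of ![a, b, c, ν]).det * (Matrix.of ![a', b', c', ν]).det) * this
  have entry : ∀ (m m' : Fin 4 → Coord) (i j : Fin 4),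
      (Matrix.of m * G x * (Matrix.of m').transpose) i j = inn G x (m i) (m' j) := by
    intro m m' i j
    rw [Matrix.mul_assoc]
    rfl
  have left : ∀ w ∈ tangent F x, inn G x ν w = 0 := fun w hw =>
    (h.inn_conormal_eq_zero_iff w).2 hw
  have right : ∀ w ∈ tangent F x, inn G x w ν = 0 := fun w hw => by
    rw [inn_comm (h.symm x), left w hw]
  rw [key, det_four, Matrix.det_fin_three]
  simp only [entry]
  simp [left _ ha', left _ hb', left _ hc', right _ ha, right _ hb, right _ hc,
    show inn G x ν ν = 1 from h.inn_conormal_self]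
  ring

end IsRegularPoint

/-! ### Compatibility of the Levi-Civita derivative with the metric -/

/-- The Christoffel symbols of the first kind, `g(Γ(u, v), w)`. -/
lemma IsRegularPoint.inn_christoffel (h : IsRegularPoint G F x) (u v w : Coord) :
    inn G x (christoffel G x u v) w = 1 / 2 * ∑ l, ∑ i, ∑ j,
      (dGram G x i j l + dGram G x j i l - dGram G x l i j) * u i * v j * w l := by
  rw [christoffel, inn_smul_left, h.inn_inv_mulVec, dotProduct]
  simp only [Finset.sum_mul]

lemma IsRegularPoint.dGram_symm (h : IsRegularPoint G F x) (i j l : Fin 4) :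
    dGram G x i j l = dGram G x i l j := by
  have : (fun y => G y j l) = fun y => G y l j := funext fun y => (h.symm y).apply l j
  rw [dGram, dGram, this]

/-- `g(Γ(u, v), w) + g(v, Γ(u, w)) = (∂_u g)(v, w)`. -/
lemma IsRegularPoint.inn_christoffel_add (h : IsRegularPoint G F x) (u v w : Coord) :
    inn G x (christoffel G x u v) w + inn G x v (christoffel G x u w) =
      ∑ j, ∑ l, (∑ i, u i * dGram G x i j l) * w l * v j := by
  rw [inn_comm (h.symm x) v, h.inn_christoffel, h.inn_christoffel]
  have e1 : (∑ l, ∑ i, ∑ j,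
      (dGram G x i j l + dGram G x j i l - dGram G x l i j) * u i * v j * w l) =
      ∑ j, ∑ l, ∑ i,
      (dGram G x i j l + dGram G x j i l - dGram G x l i j) * u i * v j * w l := by
    rw [Finset.sum_comm' (t' := Finset.univ) (s' := fun _ => Finset.univ) (by simp)]
    rw [Finset.sum_congr rfl fun i _ => Finset.sum_comm]
    rw [Finset.sum_comm]
    exact Finset.sum_congr rfl fun j _ => Finset.sum_comm
  have e2 : (∑ l, ∑ i, ∑ j,
      (dGram G x i j l + dGram G x j i l - dGram G x l i j) * u i * w j * v l) =
      ∑ j, ∑ l, ∑ i,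
      (dGram G x i l j + dGram G x l i j - dGram G x j i l) * u i * w l * v j :=
    Finset.sum_congr rfl fun j _ => Finset.sum_comm
  rw [e1, e2, ← mul_add, ← Finset.sum_add_distrib, Finset.mul_sum]
  refine Finset.sum_congr rfl fun j _ => ?_
  rw [← Finset.sum_add_distrib, Finset.mul_sum]
  refine Finset.sum_congr rfl fun l _ => ?_
  rw [← Finset.sum_add_distrib, Finset.mul_sum, Finset.sum_mul, Finset.sum_mul]
  refine Finset.sum_congr rfl fun i _ => ?_
  rw [h.dGram_symm i l j]
  ring

/-- The Levi-Civita derivative is compatible with the metric along a curve, for vector fields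
tangent to the hypersurface. -/
lemma hasDerivAt_inn {x v w : ℝ → Coord} {t : ℝ} {u dv dw : Coord}
    (h : IsRegularPoint G F (x t)) (hx : HasDerivAt x u t) (hv : HasDerivAt v dv t)
    (hw : HasDerivAt w dw t) (hvt : v t ∈ tangent F (x t)) (hwt : w t ∈ tangent F (x t)) :
    HasDerivAt (fun s => inn G (x s) (v s) (w s))
      (inn G (x t) (proj G F (x t) (dv + christoffel G (x t) u (v t))) (w t) +
        inn G (x t) (v t) (proj G F (x t) (dw + christoffel G (x t) u (w t)))) t := by
  have hg (j l : Fin 4) : HasDerivAt (fun s => G (x s) j l)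
      (∑ i, u i * dGram G (x t) i j l) t := by
    have hd := ((h.smooth_gram j l).differentiableAt (by simp)).hasFDerivAt.comp_hasDerivAt t hx
    refine hd.congr_deriv ?_
    conv_lhs => rw [← Finset.univ_sum_single u, map_sum]
    refine Finset.sum_congr rfl fun k _ => ?_
    rw [dGram, ← smul_eq_mul (u k), ← map_smul, ← Pi.single_smul, smul_eq_mul, mul_one]
  have hsum : HasDerivAt (fun s => inn G (x s) (v s) (w s))
      (∑ j, ∑ l, (((∑ i, u i * dGram G (x t) i j l) * w t l + G (x t) j l * dw l) * v t j
        + G (x t) j l * w t l * dv j)) t := by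
    simp only [inn_eq_sum]
    refine HasDerivAt.fun_sum fun j _ => HasDerivAt.fun_sum fun l _ => ?_
    exact ((hg j l).mul (hasDerivAt_pi.1 hw l)).mul (hasDerivAt_pi.1 hv j)
  convert hsum using 1
  rw [h.inn_proj_left _ hwt, inn_comm (h.symm _) (v t), h.inn_proj_left _ hvt, inn_add_left,
    inn_add_left, inn_comm (h.symm _) _ (v t), inn_comm (h.symm _) _ (v t)]
  have := h.inn_christoffel_add u (v t) (w t)
  rw [add_add_add_comm, this, inn_eq_sum dv, inn_eq_sum (v t) dw]
  simp only [← Finset.sum_add_distrib]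
  exact Finset.sum_congr rfl fun _ _ => Finset.sum_congr rfl fun _ _ => by ring

/-! ### Smooth dependence along a curve -/

lemma contDiffAt_det {n : ℕ} {M : ℝ → Matrix (Fin n) (Fin n) ℝ} {t : ℝ}
    (hM : ∀ i j, ContDiffAt ℝ ∞ (fun s => M s i j) t) :
    ContDiffAt ℝ ∞ (fun s => (M s).det) t := by
  simp only [Matrix.det_apply]
  exact ContDiffAt.sum fun σ _ => (contDiffAt_prod fun i _ => hM _ _).const_smul _

lemma contDiffAt_inv_apply {n : ℕ} {M : ℝ → Matrix (Fin n) (Fin n) ℝ} {t : ℝ}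
    (hM : ∀ i j, ContDiffAt ℝ ∞ (fun s => M s i j) t) (h0 : (M t).det ≠ 0) (i j : Fin n) :
    ContDiffAt ℝ ∞ (fun s => (M s)⁻¹ i j) t := by
  simp only [Matrix.inv_def, Matrix.smul_apply, Ring.inverse_eq_inv', smul_eq_mul,
    Matrix.adjugate_apply]
  refine ((contDiffAt_det hM).inv h0).mul (contDiffAt_det fun k l => ?_)
  by_cases hk : k = j
  · subst hk
    simpa using contDiffAt_const
  · simpa [Matrix.updateRow_ne hk] using hM k l

lemma contDiffAt_mulVec {m n : ℕ} {M : ℝ → Matrix (Fin m) (Fin n) ℝ} {v : ℝ → Fin n → ℝ} {t : ℝ}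
    (hM : ∀ i j, ContDiffAt ℝ ∞ (fun s => M s i j) t) (hv : ContDiffAt ℝ ∞ v t) :
    ContDiffAt ℝ ∞ (fun s => (M s).mulVec (v s)) t :=
  contDiffAt_pi.2 fun i => by
    simp only [Matrix.mulVec, dotProduct]
    exact ContDiffAt.sum fun j _ => (hM i j).mul (contDiffAt_pi.1 hv j)

section Smooth

variable {x u v w : ℝ → Coord} {t : ℝ}

lemma IsRegularPoint.contDiffAt_gram_comp (h : IsRegularPoint G F (x t))
    (hx : ContDiffAt ℝ ∞ x t) (i j : Fin 4) : ContDiffAt ℝ ∞ (fun s => G (x s) i j) t :=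
  (h.smooth_gram i j).comp t hx

lemma IsRegularPoint.contDiffAt_inn (h : IsRegularPoint G F (x t)) (hx : ContDiffAt ℝ ∞ x t)
    (hu : ContDiffAt ℝ ∞ u t) (hv : ContDiffAt ℝ ∞ v t) :
    ContDiffAt ℝ ∞ (fun s => inn G (x s) (u s) (v s)) t := by
  simp only [inn_eq_sum]
  exact ContDiffAt.sum fun j _ => ContDiffAt.sum fun l _ =>
    ((h.contDiffAt_gram_comp hx j l).mul (contDiffAt_pi.1 hv l)).mul (contDiffAt_pi.1 hu j)

lemma contDiffAt_fderiv_comp {f : Coord → ℝ} (hf : ContDiffAt ℝ ∞ f (x t))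
    (hx : ContDiffAt ℝ ∞ x t) (e : Coord) :
    ContDiffAt ℝ ∞ (fun s => fderiv ℝ f (x s) e) t :=
  ((hf.fderiv_right (m := ∞) (by simp)).comp t hx).clm_apply contDiffAt_const

lemma IsRegularPoint.contDiffAt_christoffel (h : IsRegularPoint G F (x t))
    (hx : ContDiffAt ℝ ∞ x t) (hu : ContDiffAt ℝ ∞ u t) (hv : ContDiffAt ℝ ∞ v t) :
    ContDiffAt ℝ ∞ (fun s => christoffel G (x s) (u s) (v s)) t := by
  have hd (i j l : Fin 4) : ContDiffAt ℝ ∞ (fun s => dGram G (x s) i j l) t :=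
    contDiffAt_fderiv_comp (h.smooth_gram j l) hx _
  refine (contDiffAt_mulVec (contDiffAt_inv_apply (h.contDiffAt_gram_comp hx) h.det_pos.ne')
    (contDiffAt_pi.2 fun l => ?_)).const_smul _
  exact ContDiffAt.sum fun i _ => ContDiffAt.sum fun j _ =>
    ((((hd i j l).add (hd j i l)).sub (hd l i j)).mul (contDiffAt_pi.1 hu i)).mul
      (contDiffAt_pi.1 hv j)

lemma IsRegularPoint.contDiffAt_conormal (h : IsRegularPoint G F (x t))
    (hx : ContDiffAt ℝ ∞ x t) : ContDiffAt ℝ ∞ (fun s => conormal G F (x s)) t := by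
  have hg : ContDiffAt ℝ ∞ (fun s => grad G F (x s)) t :=
    contDiffAt_mulVec (contDiffAt_inv_apply (h.contDiffAt_gram_comp hx) h.det_pos.ne')
      (contDiffAt_pi.2 fun l => contDiffAt_fderiv_comp h.smooth_fun hx _)
  have hp := h.pos _ h.grad_ne_zero
  exact (((h.contDiffAt_inn hx hg hg).sqrt hp.ne').inv (Real.sqrt_pos.2 hp).ne').smul hg

lemma IsRegularPoint.contDiffAt_proj (h : IsRegularPoint G F (x t))
    (hx : ContDiffAt ℝ ∞ x t) (hu : ContDiffAt ℝ ∞ u t) :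
    ContDiffAt ℝ ∞ (fun s => proj G F (x s) (u s)) t :=
  hu.sub ((h.contDiffAt_inn hx hu (h.contDiffAt_conormal hx)).smul (h.contDiffAt_conormal hx))

lemma IsRegularPoint.contDiffAt_wedge (h : IsRegularPoint G F (x t))
    (hx : ContDiffAt ℝ ∞ x t) (hu : ContDiffAt ℝ ∞ u t) (hv : ContDiffAt ℝ ∞ v t) :
    ContDiffAt ℝ ∞ (fun s => wedge G F (x s) (u s) (v s)) t := by
  refine contDiffAt_mulVec (contDiffAt_inv_apply (h.contDiffAt_gram_comp hx) h.det_pos.ne')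
    (contDiffAt_pi.2 fun k => ?_)
  refine ((contDiffAt_det (h.contDiffAt_gram_comp hx)).sqrt h.det_pos.ne').mul
    (contDiffAt_det fun i j => ?_)
  fin_cases i
  · exact contDiffAt_pi.1 hu j
  · exact contDiffAt_pi.1 hv j
  · exact contDiffAt_const
  · exact contDiffAt_pi.1 (h.contDiffAt_conormal hx) j

end Smooth

/-! ### Linear algebra of two transversal planes -/

section Pointwise

variable {u n m v : Coord}

namespace IsRegularPoint

/-- Since `u` is orthogonal to `n` and `m`, one has `m = ⟨n, m⟩ n + μ (n ∧ u)`. As `v ↦ n ∧ v` is an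
isometry of the plane orthogonal to `n`, the product `⟨n ∧ v, m⟩ ⟨n ∧ u, m⟩` is `μ² |u|² ⟨v, u⟩`,
and `μ² |u|² = 1 - ⟨n, m⟩²`. -/
lemma inn_mul_sub_sq (h : IsRegularPoint G F x) (hu : u ∈ tangent F x) (hn : n ∈ tangent F x)
    (hm : m ∈ tangent F x) (hv : v ∈ tangent F x) (hnn : inn G x n n = 1)
    (hmm : inn G x m m = 1) (hun : inn G x u n = 0) (hum : inn G x u m = 0)
    (hvn : inn G x v n = 0) :
    inn G x v u * (1 - inn G x n m ^ 2) =
      inn G x (wedge G F x n v) m * inn G x (wedge G F x n u) m := by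
  have s := inn_comm (G := G) (h.symm x)
  rw [h.inn_wedge, h.inn_wedge, h.vol_mul_vol hn hv hm hn hu hm, Matrix.det_fin_three]
  simp [hnn, hmm, hvn, s n u, s m u, hun, hum, s m n]
  ring

/-- Since `u` is orthogonal to `n` and `m`, the vector `m` is a combination of `n` and `n ∧ u`; a
vector `v` orthogonal to `n` therefore pairs with `m` through its component along `n ∧ u` only. -/
lemma inn_wedge_mul (h : IsRegularPoint G F x) (hu : u ∈ tangent F x) (hn : n ∈ tangent F x)
    (hm : m ∈ tangent F x) (hv : v ∈ tangent F x) (hnn : inn G x n n = 1)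
    (hun : inn G x u n = 0) (hum : inn G x u m = 0) (hvn : inn G x v n = 0) :
    inn G x v (wedge G F x n u) * inn G x (wedge G F x n u) m =
      inn G x u u * inn G x v m := by
  have s := inn_comm (G := G) (h.symm x)
  rw [s v, h.inn_wedge, h.inn_wedge, h.vol_mul_vol hn hu hv hn hu hm, Matrix.det_fin_three]
  simp [hnn, hvn, s n u, hun, hum]

lemma inn_wedge_sq (h : IsRegularPoint G F x) (hu : u ∈ tangent F x) (hn : n ∈ tangent F x)
    (hv : v ∈ tangent F x) (hnn : inn G x n n = 1) (hun : inn G x u n = 0)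
    (hvn : inn G x v n = 0) (hvu : inn G x v u = 0) :
    inn G x (wedge G F x n u) v ^ 2 = inn G x u u * inn G x v v := by
  have s := inn_comm (G := G) (h.symm x)
  rw [sq, h.inn_wedge, h.vol_mul_vol hn hu hv hn hu hv, Matrix.det_fin_three]
  simp [hnn, hvn, s n u, s u v, s n v, hun, hvu]

lemma inn_wedge_left (h : IsRegularPoint G F x) : inn G x (wedge G F x n u) n = 0 := by
  have := vol_swap (G := G) (F := F) (x := x) n u n
  rw [h.inn_wedge]
  linarith

lemma inn_wedge_right (h : IsRegularPoint G F x) : inn G x (wedge G F x n u) u = 0 := by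
  have := vol_swap_right (G := G) (F := F) (x := x) n u u
  rw [h.inn_wedge]
  linarith

lemma inn_wedge_swap (h : IsRegularPoint G F x) :
    inn G x (wedge G F x n u) v = -inn G x (wedge G F x n v) u := by
  rw [h.inn_wedge, h.inn_wedge, vol_swap_right]

/-- `v ↦ n ∧ v` is an isometry of the plane orthogonal to the unit vector `n`. -/
lemma inn_wedge_wedge (h : IsRegularPoint G F x) (hu : u ∈ tangent F x) (hn : n ∈ tangent F x)
    (hv : v ∈ tangent F x) (hnn : inn G x n n = 1) (hun : inn G x u n = 0)
    (hvn : inn G x v n = 0) (h0 : wedge G F x n u ≠ 0) :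
    inn G x (wedge G F x n v) (wedge G F x n u) = inn G x v u := by
  have s := inn_comm (G := G) (h.symm x)
  obtain ⟨w, hw⟩ : ∃ w, w = wedge G F x n u := ⟨_, rfl⟩
  have hwt : w ∈ tangent F x := hw ▸ h.wedge_mem _ _
  have hwn : inn G x w n = 0 := hw ▸ h.inn_wedge_left
  have hwu : inn G x w u = 0 := hw ▸ h.inn_wedge_right
  rw [← hw] at h0 ⊢
  have e : inn G x (wedge G F x n v) w * inn G x w w = inn G x v u * inn G x w w := by
    conv_lhs => enter [2]; enter [3]; rw [hw]
    rw [h.inn_wedge, h.inn_wedge, h.vol_mul_vol hn hv hwt hn hu hwt, Matrix.det_fin_three]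
    simp [hnn, hwn, hwu, hvn, s n w, s n u, hun]
  exact mul_right_cancel₀ (h.pos _ h0).ne' e

/-- Orthogonal decomposition with respect to `u`, `n ∧ u`, `n`: a vector orthogonal to `n` and to
`n ∧ u` is a multiple of `u`. -/
lemma eq_smul_of_inn_wedge_eq_zero (h : IsRegularPoint G F x) (hu : u ∈ tangent F x)
    (hn : n ∈ tangent F x) (hv : v ∈ tangent F x) (hnn : inn G x n n = 1)
    (hun : inn G x u n = 0) (hvn : inn G x v n = 0) (hu0 : u ≠ 0)
    (hw : inn G x v (wedge G F x n u) = 0) :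
    v = (inn G x v u / inn G x u u) • u := by
  have hp := h.pos u hu0
  set c := inn G x v u / inn G x u u
  by_contra hne
  have h0 : v - c • u ≠ 0 := sub_ne_zero.2 hne
  have e := h.inn_wedge_sq (v := v - c • u) hu hn (Submodule.sub_mem _ hv
    (Submodule.smul_mem _ _ hu)) hnn hun
    (by rw [inn_sub_left, inn_smul_left, hvn, hun]; ring)
    (by rw [inn_sub_left, inn_smul_left, div_mul_cancel₀ _ hp.ne', sub_self])
  rw [inn_sub_right, inn_smul_right, h.inn_wedge_right, inn_comm (h.symm x), hw] at e
  have := mul_pos hp (h.pos _ h0)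
  simp at e
  rcases e with e | e
  · exact hp.ne' e
  · exact (h.pos _ h0).ne' e

end IsRegularPoint

end Pointwise

end Ambient

/-! ### The spaces `𝔼(κ, τ)` are regular hypersurfaces -/

section Regular

variable {κ τ : ℝ} {x : Coord}

lemma contDiffAt_conf (hx : 0 < 1 + κ / 4 * (x 0 ^ 2 + x 1 ^ 2)) :
    ContDiffAt ℝ ∞ (conf κ) x := by
  unfold conf
  refine ContDiffAt.inv (by fun_prop) hx.ne'

/-- The derivative of a function that is a quadratic polynomial along a line. -/
lemma fderiv_apply_of_quadratic {f : Coord → ℝ} {x v : Coord} {b c : ℝ}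
    (hf : DifferentiableAt ℝ f x) (h : ∀ s : ℝ, f (x + s • v) = f x + b * s + c * s ^ 2) :
    fderiv ℝ f x v = b := by
  rw [← hf.lineDeriv_eq_fderiv]
  refine HasLineDerivAt.lineDeriv (HasDerivAt.congr_of_eventuallyEq ?_
    (Filter.Eventually.of_forall h))
  simpa using (((hasDerivAt_id (0 : ℝ)).const_mul b).const_add (f x)).fun_add
    ((hasDerivAt_pow 2 (0 : ℝ)).const_mul c)

lemma gram_isSymm (κ τ : ℝ) (x : Coord) : (gram κ τ x).IsSymm := by
  have hv (v : Coord) : (Matrix.vecMulVec v v).IsSymm :=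
    Matrix.IsSymm.ext fun i j => by simp [Matrix.vecMulVec_apply, mul_comm]
  unfold gram
  split_ifs
  · exact (Matrix.isSymm_diagonal _).add (hv _)
  · exact Matrix.isSymm_one
  · exact (Matrix.isSymm_one.add ((hv _).smul _)).smul _

lemma isRegularPoint_of_nonpos (hκ : κ ≤ 0) (hx : x ∈ carrier κ τ) :
    IsRegularPoint (gram κ τ) (defFun κ τ) x := by
  rw [carrier, if_pos hκ] at hx
  have hF : defFun κ τ = fun x => x 3 := funext fun x => by simp [defFun, hκ]
  refine ⟨gram_isSymm κ τ, fun v hv => ?_, fun i j => ?_, ?_, ?_⟩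
  · have hl : 0 < conf κ x := inv_pos.2 hx.1
    have e : inn (gram κ τ) x v v = (conf κ x * v 0) ^ 2 + (conf κ x * v 1) ^ 2
        + (τ * conf κ x * x 1 * v 0 - τ * conf κ x * x 0 * v 1 + v 2) ^ 2 + v 3 ^ 2 := by
      rw [inn_eq_sum]
      simp [gram, hκ, Fin.sum_univ_four, Matrix.diagonal_apply, connForm]
      ring
    rw [e]
    refine lt_of_le_of_ne (by positivity) fun h0 => hv ?_
    set a := conf κ x * v 0
    set b := conf κ x * v 1
    set c := τ * conf κ x * x 1 * v 0 - τ * conf κ x * x 0 * v 1 + v 2 with hc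
    have ha := sq_nonneg a
    have hb := sq_nonneg b
    have hc2 := sq_nonneg c
    have hd := sq_nonneg (v 3)
    have h3 : v 3 = 0 := pow_eq_zero_iff two_ne_zero |>.1 (by linarith)
    have h0' : a = 0 := pow_eq_zero_iff two_ne_zero |>.1 (by linarith)
    have h1' : b = 0 := pow_eq_zero_iff two_ne_zero |>.1 (by linarith)
    have h2' : c = 0 := pow_eq_zero_iff two_ne_zero |>.1 (by linarith)
    have h0 := (mul_eq_zero.1 h0').resolve_left hl.ne'
    have h1 := (mul_eq_zero.1 h1').resolve_left hl.ne'
    have h2 : v 2 = 0 := by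
      rw [h0, h1] at hc
      linarith
    ext i
    fin_cases i <;> assumption
  · have hc : ContDiffAt ℝ ∞ (conf κ) x := contDiffAt_conf hx.1
    have hf (k : Fin 4) : ContDiffAt ℝ ∞ (fun y => connForm κ τ y k) x := by
      fin_cases k <;> simp [connForm] <;> fun_prop
    simp only [gram, if_pos hκ, Matrix.add_apply, Matrix.vecMulVec_apply]
    refine ContDiffAt.add ?_ ((hf i).mul (hf j))
    by_cases hij : i = j
    · subst hij
      simp only [Matrix.diagonal_apply_eq]
      fin_cases i <;> simp <;> fun_prop
    · simp only [Matrix.diagonal_apply_ne _ hij]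
      exact contDiffAt_const
  · rw [hF]
    fun_prop
  · intro h0
    have hd : HasFDerivAt (fun x : Coord => x 3) (ContinuousLinearMap.proj (R := ℝ) 3) x :=
      hasFDerivAt_apply 3 x
    rw [hF, hd.fderiv] at h0
    simpa using congrArg (fun L : Coord →L[ℝ] ℝ => L (Pi.single 3 1)) h0

lemma isRegularPoint_of_pos_of_eq_zero (hκ : ¬κ ≤ 0) (hτ : τ = 0) (hx : x ∈ carrier κ τ) :
    IsRegularPoint (gram κ τ) (defFun κ τ) x := by
  rw [carrier, if_neg hκ, if_pos hτ] at hx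
  have hF : defFun κ τ = fun x => x 0 ^ 2 + x 1 ^ 2 + x 2 ^ 2 - 1 / κ :=
    funext fun x => by simp [defFun, hκ, hτ]
  refine ⟨gram_isSymm κ τ, fun v hv => ?_, fun i j => ?_, ?_, fun h0 => ?_⟩
  · have e : inn (gram κ τ) x v v = v ⬝ᵥ v := by simp [inn, gram, hκ, hτ]
    rw [e]
    exact lt_of_le_of_ne (Finset.sum_nonneg fun i _ => mul_self_nonneg _)
      (Ne.symm fun h => hv (dotProduct_self_eq_zero.1 h))
  · simp only [gram, if_neg hκ, if_pos hτ]
    exact contDiffAt_const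
  · rw [hF]
    fun_prop
  -- the radial derivative of `F` at `x` does not vanish
  · have hd := fderiv_apply_of_quadratic (f := defFun κ τ) (x := x) (v := x) (b := 2 * (1 / κ))
      (c := 1 / κ) (by rw [hF]; fun_prop) fun s => by
        rw [← show x 0 ^ 2 + x 1 ^ 2 + x 2 ^ 2 = 1 / κ from hx, hF]
        simp
        ring
    rw [h0] at hd
    simp_all

lemma isRegularPoint_of_pos_of_ne_zero (hκ : ¬κ ≤ 0) (hτ : τ ≠ 0) (hx : x ∈ carrier κ τ) :
    IsRegularPoint (gram κ τ) (defFun κ τ) x := by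
  rw [carrier, if_neg hκ, if_neg hτ] at hx
  replace hx : x 0 ^ 2 + x 1 ^ 2 + x 2 ^ 2 + x 3 ^ 2 = 1 := hx
  have hκ' : 0 < κ := not_le.1 hκ
  have hF : defFun κ τ = fun x => τ * (x 0 ^ 2 + x 1 ^ 2 + x 2 ^ 2 + x 3 ^ 2 - 1) :=
    funext fun x => by simp [defFun, hκ, hτ]
  refine ⟨gram_isSymm κ τ, fun v hv => ?_, fun i j => ?_, ?_, fun h0 => ?_⟩
  · set p := -x 1 * v 0 + x 0 * v 1 - x 3 * v 2 + x 2 * v 3 with hp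
    -- Lagrange's identity, with `p = ⟨v, i x⟩`: `r = |x|² |v|² - ⟨v, i x⟩²`
    set r := (x 0 * v 0 + x 1 * v 1) ^ 2 + (x 2 * v 2 + x 3 * v 3) ^ 2
      + (x 1 * v 2 - x 3 * v 0) ^ 2 + (x 1 * v 3 + x 2 * v 0) ^ 2
      + (x 0 * v 2 + x 3 * v 1) ^ 2 + (x 0 * v 3 - x 2 * v 1) ^ 2 with hr
    have hn : v 0 ^ 2 + v 1 ^ 2 + v 2 ^ 2 + v 3 ^ 2 = p ^ 2 + r := by
      linear_combination -(v 0 ^ 2 + v 1 ^ 2 + v 2 ^ 2 + v 3 ^ 2) * hx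
    have e : inn (gram κ τ) x v v = 4 / κ * (r + 4 * τ ^ 2 / κ * p ^ 2) := by
      have e' : inn (gram κ τ) x v v = 4 / κ *
          (v 0 ^ 2 + v 1 ^ 2 + v 2 ^ 2 + v 3 ^ 2 + (4 * τ ^ 2 / κ - 1) * p ^ 2) := by
        rw [inn_eq_sum]
        simp [gram, hκ, hτ, Fin.sum_univ_four, Matrix.one_apply, hopf, hp]
        ring
      rw [e', hn]
      ring
    have hr0 : 0 ≤ r := by positivity
    have hq : 0 < 4 * τ ^ 2 / κ := by positivity
    rw [e]
    refine mul_pos (by positivity) ((add_nonneg hr0 (by positivity)).lt_of_ne fun h0 => hv ?_)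
    have h1 : r = 0 := le_antisymm (by linarith [mul_nonneg hq.le (sq_nonneg p)]) hr0
    have h2 : p ^ 2 = 0 := by
      rw [h1, zero_add] at h0
      exact (mul_eq_zero.1 h0.symm).resolve_left hq.ne'
    have hz : v ⬝ᵥ v = 0 := by
      rw [dotProduct, Fin.sum_univ_four]
      linear_combination hn + h1 + h2
    exact dotProduct_self_eq_zero.1 hz
  · have hf (k : Fin 4) : ContDiffAt ℝ ∞ (fun y => hopf y k) x := by
      fin_cases k <;> simp [hopf] <;> fun_prop
    simp only [gram, if_neg hκ, if_neg hτ, Matrix.add_apply, Matrix.smul_apply,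
      Matrix.vecMulVec_apply]
    exact (contDiffAt_const.add (((hf i).mul (hf j)).const_smul _)).const_smul _
  · rw [hF]
    fun_prop
  -- the radial derivative of `F` at `x` does not vanish
  · have hd := fderiv_apply_of_quadratic (f := defFun κ τ) (x := x) (v := x) (b := 2 * τ)
      (c := τ) (by rw [hF]; fun_prop) fun s => by
        rw [hF]
        simp
        linear_combination (2 * s * τ + s ^ 2 * τ) * hx
    rw [h0] at hd
    simp_all

lemma isRegularPoint (hx : x ∈ carrier κ τ) : IsRegularPoint (gram κ τ) (defFun κ τ) x := by
  by_cases hκ : κ ≤ 0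
  · exact isRegularPoint_of_nonpos hκ hx
  by_cases hτ : τ = 0
  · exact isRegularPoint_of_pos_of_eq_zero hκ hτ hx
  · exact isRegularPoint_of_pos_of_ne_zero hκ hτ hx

lemma xi_mem_tangentE (hx : x ∈ carrier κ τ) : xi κ τ x ∈ tangentE κ τ x := by
  have hd := (isRegularPoint hx).smooth_fun.differentiableAt (by simp)
  change fderiv ℝ (defFun κ τ) x (xi κ τ x) = 0
  by_cases hκ : κ ≤ 0
  · exact fderiv_apply_of_quadratic (c := 0) hd fun s => by simp [defFun, xi, hκ]
  by_cases hτ : τ = 0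
  · exact fderiv_apply_of_quadratic (c := 0) hd fun s => by simp [defFun, xi, hκ, hτ]
  · refine fderiv_apply_of_quadratic (c := τ * (κ / (4 * τ)) ^ 2 *
      (x 0 ^ 2 + x 1 ^ 2 + x 2 ^ 2 + x 3 ^ 2)) hd fun s => ?_
    simp [defFun, xi, hκ, hτ, hopf]
    ring

lemma contDiff_xi (κ τ : ℝ) : ContDiff ℝ ∞ (xi κ τ) := by
  unfold xi
  split_ifs
  · exact contDiff_const
  · exact contDiff_const
  · refine ContDiff.const_smul _ (contDiff_pi.2 fun k => ?_)
    fin_cases k <;> simp [hopf] <;> fun_prop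

end Regular

/-! ### Curves with a unit normal field in `𝔼(κ, τ)` -/

variable {κ τ : ℝ}

lemma contDiffAt_deriv {y : ℝ → Coord} {s : Set ℝ} {t : ℝ} (hs : IsOpen s)
    (hy : ContDiffOn ℝ ∞ y s) (ht : t ∈ s) : ContDiffAt ℝ ∞ (deriv y) t :=
  (hy.deriv_of_isOpen hs (m := ∞) (by simp)).contDiffAt (hs.mem_nhds ht)

lemma defFun_eq_zero {x : Coord} (hx : x ∈ carrier κ τ) : defFun κ τ x = 0 := by
  unfold carrier at hx
  unfold defFun
  split_ifs at hx ⊢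
  · exact hx.2
  · rw [show x 0 ^ 2 + x 1 ^ 2 + x 2 ^ 2 = 1 / κ from hx, sub_self]
  · rw [show x 0 ^ 2 + x 1 ^ 2 + x 2 ^ 2 + x 3 ^ 2 = 1 from hx, sub_self, mul_zero]

/-- `x` is a smooth regular curve in `𝔼(κ, τ)`, and `n` a smooth unit normal field along it, over
the parameter set `s`. -/
structure IsNormalAlong (κ τ : ℝ) (x n : ℝ → Coord) (s : Set ℝ) : Prop where
  isOpen : IsOpen s
  smooth : ContDiffOn ℝ ∞ x s
  normal_smooth : ContDiffOn ℝ ∞ n s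
  mem : ∀ t ∈ s, x t ∈ carrier κ τ
  deriv_ne : ∀ t ∈ s, deriv x t ≠ 0
  normal_mem : ∀ t ∈ s, n t ∈ tangentE κ τ (x t)
  normal_unit : ∀ t ∈ s, metric κ τ (x t) (n t) (n t) = 1
  normal_orth : ∀ t ∈ s, metric κ τ (x t) (deriv x t) (n t) = 0

/-- The vector `A x' = -∇_{x'} n` along a curve `x` with unit normal field `n`. -/
def shapeAlong (κ τ : ℝ) (x n : ℝ → Coord) (t : ℝ) : Coord :=
  -covDeriv κ τ (x t) (deriv x t) (n t) (deriv n t)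

/-- The value at `x'` of the Abresch-Rosenberg shape operator, in terms of a curve `x` in the
surface and the unit normal `n` along it. -/
def shapeARAlong (κ τ : ℝ) (x n : ℝ → Coord) (H θ t : ℝ) : Coord :=
  let g := metric κ τ (x t)
  let A := shapeAlong κ τ x n t
  let u := deriv x t
  let T := vertTan κ τ x n t
  let Tθ := vertTanRot κ τ x n θ t
  let α := (κ - 4 * τ ^ 2) / (2 * √(H ^ 2 + τ ^ 2))
  if τ = 0 then
    (2 * H) • A - (κ * g u T) • T + (κ / 2 * g T T) • u - (2 * H ^ 2) • u
  else
    A - (α * g Tθ u) • Tθ + (α * g T T / 2) • u - H • u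

lemma shapeARAlong_congr {x y n : ℝ → Coord} {t : ℝ} (h : x t = y t)
    (hd : deriv x t = deriv y t) (H θ : ℝ) :
    shapeARAlong κ τ x n H θ t = shapeARAlong κ τ y n H θ t := by
  simp only [shapeARAlong, shapeAlong, vertTan, vertTanRot, rot, h, hd]

namespace IsNormalAlong

variable {x n m : ℝ → Coord} {s : Set ℝ} {t : ℝ}

lemma reg (h : IsNormalAlong κ τ x n s) (ht : t ∈ s) :
    IsRegularPoint (gram κ τ) (defFun κ τ) (x t) := isRegularPoint (h.mem t ht)

lemma contDiffAt (h : IsNormalAlong κ τ x n s) (ht : t ∈ s) : ContDiffAt ℝ ∞ x t :=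
  h.smooth.contDiffAt (h.isOpen.mem_nhds ht)

lemma normal_contDiffAt (h : IsNormalAlong κ τ x n s) (ht : t ∈ s) : ContDiffAt ℝ ∞ n t :=
  h.normal_smooth.contDiffAt (h.isOpen.mem_nhds ht)

lemma hasDerivAt (h : IsNormalAlong κ τ x n s) (ht : t ∈ s) : HasDerivAt x (deriv x t) t :=
  ((h.contDiffAt ht).differentiableAt (by simp)).hasDerivAt

lemma normal_hasDerivAt (h : IsNormalAlong κ τ x n s) (ht : t ∈ s) :
    HasDerivAt n (deriv n t) t :=
  ((h.normal_contDiffAt ht).differentiableAt (by simp)).hasDerivAt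

lemma deriv_mem (h : IsNormalAlong κ τ x n s) (ht : t ∈ s) :
    deriv x t ∈ tangentE κ τ (x t) := by
  have hd := (((h.reg ht).smooth_fun.differentiableAt (by simp)).hasFDerivAt.comp_hasDerivAt t
    (h.hasDerivAt ht))
  have h0 : HasDerivAt (defFun κ τ ∘ x) 0 t :=
    (hasDerivAt_const t (0 : ℝ)).congr_of_eventuallyEq
      (Filter.eventually_of_mem (h.isOpen.mem_nhds ht) fun r hr => defFun_eq_zero (h.mem r hr))
  exact hd.unique h0

lemma shapeAlong_mem (h : IsNormalAlong κ τ x n s) (ht : t ∈ s) :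
    shapeAlong κ τ x n t ∈ tangentE κ τ (x t) :=
  Submodule.neg_mem _ ((h.reg ht).proj_mem _)

/-- Joachimsthal's argument: if two unit normal fields along a curve make a constant angle, then
`⟨A₁ x', N₂⟩ + ⟨A₂ x', N₁⟩ = 0`. -/
lemma inn_shapeAlong_add (h : IsNormalAlong κ τ x n s) (h' : IsNormalAlong κ τ x m s) {c : ℝ}
    (hc : ∀ r ∈ s, metric κ τ (x r) (n r) (m r) = c) (ht : t ∈ s) :
    inn (gram κ τ) (x t) (shapeAlong κ τ x n t) (m t)
      + inn (gram κ τ) (x t) (shapeAlong κ τ x m t) (n t) = 0 := by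
  have hd := hasDerivAt_inn (h.reg ht) (h.hasDerivAt ht) (h.normal_hasDerivAt ht)
    (h'.normal_hasDerivAt ht) (h.normal_mem t ht) (h'.normal_mem t ht)
  have h0 : HasDerivAt (fun r => inn (gram κ τ) (x r) (n r) (m r)) 0 t :=
    (hasDerivAt_const t c).congr_of_eventuallyEq
      (Filter.eventually_of_mem (h.isOpen.mem_nhds ht) fun r hr => hc r hr)
  have e := hd.unique h0
  rw [inn_comm ((h.reg ht).symm _) (n t)] at e
  simp only [shapeAlong, inn_neg_left, covDeriv]
  linarith

lemma inn_shapeAlong (h : IsNormalAlong κ τ x n s) (ht : t ∈ s) :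
    inn (gram κ τ) (x t) (shapeAlong κ τ x n t) (n t) = 0 := by
  have := h.inn_shapeAlong_add h h.normal_unit ht
  linarith

lemma vertTan_mem (h : IsNormalAlong κ τ x n s) (ht : t ∈ s) :
    vertTan κ τ x n t ∈ tangentE κ τ (x t) :=
  Submodule.sub_mem _ (xi_mem_tangentE (h.mem t ht)) (Submodule.smul_mem _ _ (h.normal_mem t ht))

lemma inn_vertTan (h : IsNormalAlong κ τ x n s) (ht : t ∈ s) :
    inn (gram κ τ) (x t) (vertTan κ τ x n t) (n t) = 0 := by
  have e : inn (gram κ τ) (x t) (n t) (n t) = 1 := h.normal_unit t ht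
  rw [vertTan, inn_sub_left, inn_smul_left, e, inn_comm ((h.reg ht).symm _) (xi κ τ (x t)), metric]
  ring

lemma rot_mem (h : IsNormalAlong κ τ x n s) (ht : t ∈ s) (v : Coord) :
    rot κ τ x n t v ∈ tangentE κ τ (x t) :=
  (h.reg ht).wedge_mem _ _

lemma vertTanRot_mem (h : IsNormalAlong κ τ x n s) (ht : t ∈ s) (θ : ℝ) :
    vertTanRot κ τ x n θ t ∈ tangentE κ τ (x t) :=
  Submodule.add_mem _ (Submodule.smul_mem _ _ (h.vertTan_mem ht))
    (Submodule.smul_mem _ _ (h.rot_mem ht _))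

lemma inn_vertTanRot (h : IsNormalAlong κ τ x n s) (ht : t ∈ s) (θ : ℝ) :
    inn (gram κ τ) (x t) (vertTanRot κ τ x n θ t) (n t) = 0 := by
  have e : inn (gram κ τ) (x t) (rot κ τ x n t (vertTan κ τ x n t)) (n t) = 0 :=
    (h.reg ht).inn_wedge_left
  rw [vertTanRot, inn_add_left, inn_smul_left, inn_smul_left, h.inn_vertTan ht, e]
  ring

lemma shapeARAlong_mem (h : IsNormalAlong κ τ x n s) (ht : t ∈ s) (H θ : ℝ) :
    shapeARAlong κ τ x n H θ t ∈ tangentE κ τ (x t) := by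
  have hA := h.shapeAlong_mem ht
  have hu := h.deriv_mem ht
  have hT := h.vertTan_mem ht
  have hTθ := h.vertTanRot_mem ht θ
  unfold shapeARAlong
  split_ifs
  · exact Submodule.sub_mem _ (Submodule.add_mem _ (Submodule.sub_mem _ (Submodule.smul_mem _ _ hA)
      (Submodule.smul_mem _ _ hT)) (Submodule.smul_mem _ _ hu)) (Submodule.smul_mem _ _ hu)
  · exact Submodule.sub_mem _ (Submodule.add_mem _ (Submodule.sub_mem _ hA
      (Submodule.smul_mem _ _ hTθ)) (Submodule.smul_mem _ _ hu)) (Submodule.smul_mem _ _ hu)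

lemma inn_shapeARAlong (h : IsNormalAlong κ τ x n s) (ht : t ∈ s) (H θ : ℝ) :
    inn (gram κ τ) (x t) (shapeARAlong κ τ x n H θ t) (n t) = 0 := by
  have hu : inn (gram κ τ) (x t) (deriv x t) (n t) = 0 := h.normal_orth t ht
  unfold shapeARAlong
  split_ifs <;>
  simp only [inn_sub_left, inn_add_left, inn_smul_left, h.inn_shapeAlong ht, hu,
    h.inn_vertTan ht, h.inn_vertTanRot ht] <;> ring

lemma contDiffAt_shapeARAlong (h : IsNormalAlong κ τ x n s) (ht : t ∈ s) (H θ : ℝ) :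
    ContDiffAt ℝ ∞ (shapeARAlong κ τ x n H θ) t := by
  have r := h.reg ht
  have hx := h.contDiffAt ht
  have hn := h.normal_contDiffAt ht
  have hu : ContDiffAt ℝ ∞ (deriv x) t := contDiffAt_deriv h.isOpen h.smooth ht
  have hdn : ContDiffAt ℝ ∞ (deriv n) t := contDiffAt_deriv h.isOpen h.normal_smooth ht
  have hA : ContDiffAt ℝ ∞ (shapeAlong κ τ x n) t :=
    (r.contDiffAt_proj hx (hdn.add (r.contDiffAt_christoffel hx hu hn))).neg
  have hξ : ContDiffAt ℝ ∞ (fun t => xi κ τ (x t)) t := (contDiff_xi κ τ).contDiffAt.comp t hx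
  have hT : ContDiffAt ℝ ∞ (vertTan κ τ x n) t := hξ.sub ((r.contDiffAt_inn hx hn hξ).smul hn)
  have hTθ : ContDiffAt ℝ ∞ (vertTanRot κ τ x n θ) t :=
    (hT.const_smul (Real.cos θ)).add ((r.contDiffAt_wedge hx hn hT).const_smul (Real.sin θ))
  by_cases hτ : τ = 0
  · have : shapeARAlong κ τ x n H θ = _ := funext fun t => if_pos hτ
    rw [this]
    exact (((hA.const_smul _).sub ((contDiffAt_const.mul (r.contDiffAt_inn hx hu hT)).smul hT)).add
      ((contDiffAt_const.mul (r.contDiffAt_inn hx hT hT)).smul hu)).sub (hu.const_smul _)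
  · have : shapeARAlong κ τ x n H θ = _ := funext fun t => if_neg hτ
    rw [this]
    exact ((hA.sub ((contDiffAt_const.mul (r.contDiffAt_inn hx hTθ hu)).smul hTθ)).add
      (((contDiffAt_const.mul (r.contDiffAt_inn hx hT hT)).div_const 2).smul hu)).sub
      (hu.const_smul _)

lemma congr {y : ℝ → Coord} (h : IsNormalAlong κ τ x n s) (hxy : Set.EqOn y x s) :
    IsNormalAlong κ τ y n s := by
  have hd : ∀ t ∈ s, deriv y t = deriv x t := fun t ht =>
    (hxy.eventuallyEq_of_mem (h.isOpen.mem_nhds ht)).deriv_eq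
  refine ⟨h.isOpen, h.smooth.congr hxy, h.normal_smooth, fun t ht => ?_, fun t ht => ?_,
    fun t ht => ?_, fun t ht => ?_, fun t ht => ?_⟩ <;>
  simp only [hxy ht, hd t ht]
  exacts [h.mem t ht, h.deriv_ne t ht, h.normal_mem t ht, h.normal_unit t ht, h.normal_orth t ht]

/-- A curve is a line of curvature iff `⟨S x', J x'⟩ = 0` along it; the eigenvalue
`⟨S x', x'⟩ / ⟨x', x'⟩` is then automatically smooth. -/
lemma exists_eigenvalue_iff (h : IsNormalAlong κ τ x n s) (H θ : ℝ) :
    (∃ l : ℝ → ℝ, ContDiffOn ℝ ∞ l s ∧ ∀ t ∈ s,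
      shapeARAlong κ τ x n H θ t = l t • deriv x t) ↔
    ∀ t ∈ s, inn (gram κ τ) (x t) (shapeARAlong κ τ x n H θ t)
      (rot κ τ x n t (deriv x t)) = 0 := by
  constructor
  · rintro ⟨l, -, hl⟩ t ht
    have e : inn (gram κ τ) (x t) (rot κ τ x n t (deriv x t)) (deriv x t) = 0 :=
      (h.reg ht).inn_wedge_right
    rw [hl t ht, inn_smul_left, inn_comm ((h.reg ht).symm _), e, mul_zero]
  · intro h0
    refine ⟨fun t => inn (gram κ τ) (x t) (shapeARAlong κ τ x n H θ t) (deriv x t) /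
      inn (gram κ τ) (x t) (deriv x t) (deriv x t), fun t ht => ?_, fun t ht => ?_⟩
    · have hu := contDiffAt_deriv h.isOpen h.smooth ht
      exact (((h.reg ht).contDiffAt_inn (h.contDiffAt ht) (h.contDiffAt_shapeARAlong ht H θ)
        hu).div ((h.reg ht).contDiffAt_inn (h.contDiffAt ht) hu hu)
        ((h.reg ht).pos _ (h.deriv_ne t ht)).ne').contDiffWithinAt
    · exact (h.reg ht).eq_smul_of_inn_wedge_eq_zero (h.deriv_mem ht) (h.normal_mem t ht)
        (h.shapeARAlong_mem ht H θ) (h.normal_unit t ht) (h.normal_orth t ht)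
        (h.inn_shapeARAlong ht H θ) (h.deriv_ne t ht) (h0 t ht)

/-- `⟨S x', J x'⟩` in the form common to `τ = 0` and `τ ≠ 0`: for `τ = 0` the phase is
`e^{2iθ} = H / |H|`, so that `⟨T_θ, x'⟩ ⟨T_θ, J x'⟩ = (H / |H|) ⟨T, x'⟩ ⟨T, J x'⟩`. -/
lemma inn_shapeARAlong_rot (h : IsNormalAlong κ τ x n s) (ht : t ∈ s) {H θ : ℝ}
    (hH : H ^ 2 + τ ^ 2 ≠ 0) (hθ : IsPhase H τ θ) (hJ : rot κ τ x n t (deriv x t) ≠ 0) :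
    inn (gram κ τ) (x t) (shapeARAlong κ τ x n H θ t) (rot κ τ x n t (deriv x t)) =
      (if τ = 0 then 2 * H else 1) *
      (inn (gram κ τ) (x t) (shapeAlong κ τ x n t) (rot κ τ x n t (deriv x t)) -
        (κ - 4 * τ ^ 2) / (2 * √(H ^ 2 + τ ^ 2)) *
        (inn (gram κ τ) (x t) (vertTanRot κ τ x n θ t) (deriv x t) *
          inn (gram κ τ) (x t) (vertTanRot κ τ x n θ t) (rot κ τ x n t (deriv x t)))) := by
  have r := h.reg ht
  have sy := inn_comm (r.symm (x t))
  have e0 : inn (gram κ τ) (x t) (deriv x t) (rot κ τ x n t (deriv x t)) = 0 := by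
    rw [sy]
    exact r.inn_wedge_right
  unfold shapeARAlong
  split_ifs with hτ
  · simp only [inn_sub_left, inn_add_left, inn_smul_left, e0, metric]
    have e1 : inn (gram κ τ) (x t) (rot κ τ x n t (vertTan κ τ x n t))
        (rot κ τ x n t (deriv x t)) = inn (gram κ τ) (x t) (vertTan κ τ x n t) (deriv x t) :=
      r.inn_wedge_wedge (h.deriv_mem ht) (h.normal_mem t ht) (h.vertTan_mem ht)
        (h.normal_unit t ht) (h.normal_orth t ht) (h.inn_vertTan ht) hJ
    have e2 : inn (gram κ τ) (x t) (rot κ τ x n t (vertTan κ τ x n t)) (deriv x t) =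
        -inn (gram κ τ) (x t) (vertTan κ τ x n t) (rot κ τ x n t (deriv x t)) := by
      rw [sy (vertTan κ τ x n t)]
      exact r.inn_wedge_swap
    rw [vertTanRot, inn_add_left, inn_add_left, inn_smul_left, inn_smul_left, inn_smul_left,
      inn_smul_left, e1, e2, sy (deriv x t)]
    have hH0 : H ≠ 0 := by
      rintro rfl
      simp [hτ] at hH
    have hsq : √(H ^ 2 + τ ^ 2) = |H| := by rw [hτ, ← Real.sqrt_sq_eq_abs]; simp
    have hphase : Complex.exp (((2 * θ : ℝ) : ℂ) * Complex.I) = ((H / |H| : ℝ) : ℂ) := by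
      have := hθ
      rw [IsPhase, hsq, hτ] at this
      rw [← show 2 * Complex.I * θ = ((2 * θ : ℝ) : ℂ) * Complex.I by push_cast; ring, this]
      push_cast
      simp
    have hc : Real.cos (2 * θ) = H / |H| := by
      simpa only [Complex.exp_ofReal_mul_I_re, Complex.ofReal_re] using congrArg Complex.re hphase
    have hs : Real.sin (2 * θ) = 0 := by
      simpa only [Complex.exp_ofReal_mul_I_im, Complex.ofReal_im] using congrArg Complex.im hphase
    rw [hsq]
    subst hτ
    generalize inn (gram κ 0) (x t) (vertTan κ 0 x n t) (deriv x t) = a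
    generalize inn (gram κ 0) (x t) (vertTan κ 0 x n t) (rot κ 0 x n t (deriv x t)) = b
    have key : (Real.cos θ * a + Real.sin θ * -b) * (Real.cos θ * b + Real.sin θ * a) =
        H / |H| * (a * b) := by
      rw [Real.sin_two_mul] at hs
      rw [Real.cos_two_mul] at hc
      linear_combination (a ^ 2 - b ^ 2) / 2 * hs + a * b * hc - a * b * Real.sin_sq_add_cos_sq θ
    have ha : |H| ≠ 0 := abs_ne_zero.2 hH0
    have hk : κ / (2 * |H|) * (H / |H| * (a * b)) * (2 * H) = κ * (a * b) := by
      field_simp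
      rw [sq_abs]
    rw [key]
    linear_combination hk
  · simp only [inn_sub_left, inn_add_left, inn_smul_left, e0, metric]
    ring

/-- Along a curve with two unit normal fields `n`, `m` at a constant angle, condition `hb` makes the
eigenvector conditions of the two surfaces equivalent: both `⟨A x', J x'⟩` and
`α ⟨T_θ, x'⟩ ⟨T_θ, J x'⟩` take the same value for `n` and for `m`. -/
lemma inn_shapeARAlong_rot_eq_zero_iff (h : IsNormalAlong κ τ x n s)
    (h' : IsNormalAlong κ τ x m s) (ht : t ∈ s) {H₁ H₂ θ₁ θ₂ : ℝ}
    (hH₁ : H₁ ^ 2 + τ ^ 2 ≠ 0) (hH₂ : H₂ ^ 2 + τ ^ 2 ≠ 0)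
    (hθ₁ : IsPhase H₁ τ θ₁) (hθ₂ : IsPhase H₂ τ θ₂) {c : ℝ}
    (hc : ∀ r ∈ s, metric κ τ (x r) (n r) (m r) = c) (hc1 : c ^ 2 ≠ 1)
    (hb : √(H₁ ^ 2 + τ ^ 2) * metric κ τ (x t) (vertTanRot κ τ x m θ₂ t) (n t)
        * metric κ τ (x t) (rot κ τ x m t (vertTanRot κ τ x m θ₂ t)) (n t)
      = √(H₂ ^ 2 + τ ^ 2) * metric κ τ (x t) (vertTanRot κ τ x n θ₁ t) (m t)
        * metric κ τ (x t) (rot κ τ x n t (vertTanRot κ τ x n θ₁ t)) (m t)) :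
    inn (gram κ τ) (x t) (shapeARAlong κ τ x n H₁ θ₁ t) (rot κ τ x n t (deriv x t)) = 0 ↔
    inn (gram κ τ) (x t) (shapeARAlong κ τ x m H₂ θ₂ t) (rot κ τ x m t (deriv x t)) = 0 := by
  have r := h.reg ht
  have sy := inn_comm (r.symm (x t))
  have hu := h.deriv_mem ht
  have hn := h.normal_mem t ht
  have hm := h'.normal_mem t ht
  have hnn := h.normal_unit t ht
  have hmm := h'.normal_unit t ht
  have hun := h.normal_orth t ht
  have hum := h'.normal_orth t ht
  have hnm : inn (gram κ τ) (x t) (n t) (m t) = c := hc t ht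
  have hmn : inn (gram κ τ) (x t) (m t) (n t) = c := sy _ _ ▸ hnm
  have hc1' : 1 - c ^ 2 ≠ 0 := sub_ne_zero.2 hc1.symm
  have hp := r.pos _ (h.deriv_ne t ht)
  -- the two rotated velocities pair with the other normal with opposite signs
  have hD : inn (gram κ τ) (x t) (rot κ τ x m t (deriv x t)) (n t) =
      -inn (gram κ τ) (x t) (rot κ τ x n t (deriv x t)) (m t) := by
    change inn _ _ (wedge _ _ _ _ _) _ = -inn _ _ (wedge _ _ _ _ _) _
    rw [r.inn_wedge, r.inn_wedge, vol_swap]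
  have hD2 : inn (gram κ τ) (x t) (rot κ τ x n t (deriv x t)) (m t) ≠ 0 := by
    intro h0
    have := r.inn_mul_sub_sq hu hn hm hu hnn hmm hun hum hun
    rw [hnm, show inn (gram κ τ) (x t) (wedge (gram κ τ) (defFun κ τ) (x t) (n t) (deriv x t))
      (m t) = 0 from h0, mul_zero] at this
    exact mul_ne_zero hp.ne' hc1' this
  have hJn : rot κ τ x n t (deriv x t) ≠ 0 := fun h0 => hD2 (by simp [h0, inn])
  have hJm : rot κ τ x m t (deriv x t) ≠ 0 := fun h0 => hD2 (by
    rw [← neg_eq_zero, ← hD]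
    simp [h0, inn])
  rw [h.inn_shapeARAlong_rot ht hH₁ hθ₁ hJn, h'.inn_shapeARAlong_rot ht hH₂ hθ₂ hJm]
  have hk (H : ℝ) (hH : H ^ 2 + τ ^ 2 ≠ 0) : (if τ = 0 then 2 * H else 1) ≠ 0 := by
    split_ifs with hτ
    · rintro h0
      simp_all
    · exact one_ne_zero
  rw [mul_eq_zero, mul_eq_zero, or_iff_right (hk _ hH₁), or_iff_right (hk _ hH₂)]
  have a₁ := r.inn_wedge_mul hu hn hm (h.shapeAlong_mem ht) hnn hun hum (h.inn_shapeAlong ht)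
  have a₂ := r.inn_wedge_mul hu hm hn (h'.shapeAlong_mem ht) hmm hum hun (h'.inn_shapeAlong ht)
  have ha := h.inn_shapeAlong_add h' hc ht
  have p₁ := r.inn_mul_sub_sq hu hn hm (h.vertTanRot_mem ht θ₁) hnn hmm hun hum
    (h.inn_vertTanRot ht θ₁)
  have p₂ := r.inn_mul_sub_sq hu hm hn (h'.vertTanRot_mem ht θ₂) hmm hnn hum hun
    (h'.inn_vertTanRot ht θ₂)
  have q₁ := r.inn_wedge_mul hu hn hm (h.vertTanRot_mem ht θ₁) hnn hun hum (h.inn_vertTanRot ht θ₁)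
  have q₂ := r.inn_wedge_mul hu hm hn (h'.vertTanRot_mem ht θ₂) hmm hum hun
    (h'.inn_vertTanRot ht θ₂)
  rw [hnm] at p₁
  rw [hmn] at p₂
  have hr₁ : √(H₁ ^ 2 + τ ^ 2) ≠ 0 :=
    (Real.sqrt_pos.2 (lt_of_le_of_ne (by positivity) hH₁.symm)).ne'
  have hr₂ : √(H₂ ^ 2 + τ ^ 2) ≠ 0 :=
    (Real.sqrt_pos.2 (lt_of_le_of_ne (by positivity) hH₂.symm)).ne'
  simp only [rot, wedgeE, metric] at hD hD2 hb ⊢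
  rw [hD] at a₂ p₂ q₂
  generalize √(H₁ ^ 2 + τ ^ 2) = r₁ at *
  generalize √(H₂ ^ 2 + τ ^ 2) = r₂ at *
  generalize inn (gram κ τ) (x t) (wedge (gram κ τ) (defFun κ τ) (x t) (n t) (deriv x t)) (m t)
    = D at *
  have hA : inn (gram κ τ) (x t) (shapeAlong κ τ x n t)
        (wedge (gram κ τ) (defFun κ τ) (x t) (n t) (deriv x t)) =
      inn (gram κ τ) (x t) (shapeAlong κ τ x m t)
        (wedge (gram κ τ) (defFun κ τ) (x t) (m t) (deriv x t)) := by
    refine mul_right_cancel₀ hD2 ?_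
    linear_combination a₁ + a₂ + inn (gram κ τ) (x t) (deriv x t) (deriv x t) * ha
  have hT : r₂ * (inn (gram κ τ) (x t) (vertTanRot κ τ x n θ₁ t) (deriv x t) *
        inn (gram κ τ) (x t) (vertTanRot κ τ x n θ₁ t)
          (wedge (gram κ τ) (defFun κ τ) (x t) (n t) (deriv x t))) =
      r₁ * (inn (gram κ τ) (x t) (vertTanRot κ τ x m θ₂ t) (deriv x t) *
        inn (gram κ τ) (x t) (vertTanRot κ τ x m θ₂ t)
          (wedge (gram κ τ) (defFun κ τ) (x t) (m t) (deriv x t))) := by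
    refine mul_right_cancel₀ (mul_ne_zero hc1' hD2) ?_
    generalize inn (gram κ τ) (x t) (vertTanRot κ τ x n θ₁ t) (deriv x t) = v₁ at *
    generalize inn (gram κ τ) (x t) (vertTanRot κ τ x m θ₂ t) (deriv x t) = v₂ at *
    generalize inn (gram κ τ) (x t) (vertTanRot κ τ x n θ₁ t)
          (wedge (gram κ τ) (defFun κ τ) (x t) (n t) (deriv x t)) = w₁ at *
    generalize inn (gram κ τ) (x t) (vertTanRot κ τ x m θ₂ t)
          (wedge (gram κ τ) (defFun κ τ) (x t) (m t) (deriv x t)) = w₂ at *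
    generalize inn (gram κ τ) (x t) (deriv x t) (deriv x t) = U at *
    generalize inn (gram κ τ) (x t) (wedge (gram κ τ) (defFun κ τ) (x t) (n t)
      (vertTanRot κ τ x n θ₁ t)) (m t) = j₁ at *
    generalize inn (gram κ τ) (x t) (wedge (gram κ τ) (defFun κ τ) (x t) (m t)
      (vertTanRot κ τ x m θ₂ t)) (n t) = j₂ at *
    linear_combination r₂ * w₁ * D * p₁ + r₂ * j₁ * D * q₁ - r₁ * w₂ * D * p₂ - r₁ * j₂ * D * q₂
      - U * D * hb
  rw [hA]
  have hα : ∀ q₁ q₂ : ℝ, r₂ * q₁ = r₁ * q₂ →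
      (κ - 4 * τ ^ 2) / (2 * r₁) * q₁ = (κ - 4 * τ ^ 2) / (2 * r₂) * q₂ := by
    intro q₁ q₂ hq
    field_simp
    linear_combination (κ - 4 * τ ^ 2) * hq
  rw [hα _ _ hT]

end IsNormalAlong

/-! ### Curves in surfaces -/

section Surface

variable {M : Type*} [TopologicalSpace M] {I : ModelWithCorners ℝ (EuclideanSpace ℝ (Fin 2)) M}
  {S : Type*} [TopologicalSpace S] [ChartedSpace M S]

/-- The chain rule for a map on a surface, along a curve. -/
lemma hasDerivAt_comp_velocity {f : S → Coord} {γ : ℝ → S} {t : ℝ}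
    (hf : ContMDiff I 𝓘(ℝ, Coord) ∞ f) (hγ : ContMDiffAt 𝓘(ℝ, ℝ) I ∞ γ t) :
    HasDerivAt (f ∘ γ) (diff I f (γ t) (velocity I γ t)) t := by
  have h := ((hf.mdifferentiable (by simp)) (γ t)).hasMFDerivAt.comp t
    (hγ.mdifferentiableAt (by simp)).hasMFDerivAt
  have h' : HasFDerivAt (f ∘ γ) ((diff I f (γ t)).comp
      (mfderiv 𝓘(ℝ, ℝ) I γ t : ℝ →L[ℝ] EuclideanSpace ℝ (Fin 2))) t := h.hasFDerivAt
  exact h'.hasDerivAt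

variable {φ N : S → Coord} {γ : ℝ → S} {ε : ℝ}

lemma IsOrientedImmersion.isNormalAlong (h : IsOrientedImmersion I κ τ φ N)
    (hγ : ContMDiffOn 𝓘(ℝ, ℝ) I ∞ γ (Set.Ioo (-ε) ε))
    (hreg : ∀ t ∈ Set.Ioo (-ε) ε, deriv (φ ∘ γ) t ≠ 0) :
    IsNormalAlong κ τ (φ ∘ γ) (N ∘ γ) (Set.Ioo (-ε) ε) where
  isOpen := isOpen_Ioo
  smooth := (h.smooth.comp_contMDiffOn hγ).contDiffOn
  normal_smooth := (h.normal_smooth.comp_contMDiffOn hγ).contDiffOn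
  mem _ _ := h.mem _
  deriv_ne := hreg
  normal_mem _ _ := h.normal_mem _
  normal_unit _ _ := h.normal_unit _
  normal_orth t ht := by
    rw [(hasDerivAt_comp_velocity h.smooth (hγ.contMDiffAt (isOpen_Ioo.mem_nhds ht))).deriv]
    exact h.normal_orth _ _

lemma IsOrientedImmersion.isARLine_iff (h : IsOrientedImmersion I κ τ φ N)
    (hγ : ContMDiffOn 𝓘(ℝ, ℝ) I ∞ γ (Set.Ioo (-ε) ε)) (H θ : ℝ) :
    IsARLine I κ τ φ N H θ ε γ ↔
      ∃ l : ℝ → ℝ, ContDiffOn ℝ ∞ l (Set.Ioo (-ε) ε) ∧ ∀ t ∈ Set.Ioo (-ε) ε,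
        shapeARAlong κ τ (φ ∘ γ) (N ∘ γ) H θ t = l t • deriv (φ ∘ γ) t := by
  refine exists_congr fun l => and_congr_right fun _ => forall₂_congr fun t ht => ?_
  have hγt := hγ.contMDiffAt (isOpen_Ioo.mem_nhds ht)
  rw [shapeARAlong, shapeAlong, (hasDerivAt_comp_velocity h.smooth hγt).deriv,
    (hasDerivAt_comp_velocity h.normal_smooth hγt).deriv]
  rfl

end Surface

/-- Transversal surfaces have linearly independent unit normals. -/
lemma sq_inn_normal_ne_one {x n m : Coord} {P Q : Submodule ℝ Coord} (hx : x ∈ carrier κ τ)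
    (hn : n ∈ tangentE κ τ x) (hnn : metric κ τ x n n = 1) (hmm : metric κ τ x m m = 1)
    (hP : ∀ v ∈ P, metric κ τ x v n = 0) (hQ : ∀ v ∈ Q, metric κ τ x v m = 0)
    (hPQ : P ⊔ Q = tangentE κ τ x) : metric κ τ x n m ^ 2 ≠ 1 := by
  intro hc
  simp only [metric] at *
  have r := isRegularPoint hx
  have hz : n - inn (gram κ τ) x n m • m = 0 := by
    by_contra hne
    refine (r.pos _ hne).ne' ?_
    simp only [inn_sub_left, inn_sub_right, inn_smul_left, inn_smul_right, hnn, hmm,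
      inn_comm (r.symm x) m n]
    linear_combination -hc
  obtain ⟨v, hv, w, hw, hvw⟩ := Submodule.mem_sup.1 (hPQ ▸ hn)
  have hwn : inn (gram κ τ) x w n = 0 := by
    rw [sub_eq_zero.1 hz, inn_smul_right, hQ w hw, mul_zero]
  have : inn (gram κ τ) x n n = 0 := by
    conv_lhs => enter [3]; rw [← hvw]
    rw [inn_add_left, hP v hv, hwn, add_zero]
  rw [hnn] at this
  exact one_ne_zero this

end EKT

end

theorem mainTheorem4 (κ τ : ℝ) (hκτ : κ - 4 * τ ^ 2 ≠ 0)
    {M₁ : Type*} [TopologicalSpace M₁]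
    (I₁ : ModelWithCorners ℝ (EuclideanSpace ℝ (Fin 2)) M₁)
    {S₁ : Type*} [TopologicalSpace S₁] [ChartedSpace M₁ S₁] [IsManifold I₁ ∞ S₁]
    {M₂ : Type*} [TopologicalSpace M₂]
    (I₂ : ModelWithCorners ℝ (EuclideanSpace ℝ (Fin 2)) M₂)
    {S₂ : Type*} [TopologicalSpace S₂] [ChartedSpace M₂ S₂] [IsManifold I₂ ∞ S₂]
    (φ₁ N₁ : S₁ → EKT.Coord) (φ₂ N₂ : S₂ → EKT.Coord) (H₁ H₂ θ₁ θ₂ : ℝ)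
    -- two surfaces of constant mean curvature in `𝔼(κ, τ)`
    (hS₁ : EKT.IsHSurface I₁ κ τ φ₁ N₁ H₁) (hS₂ : EKT.IsHSurface I₂ κ τ φ₂ N₂ H₂)
    (hH₁ : H₁ ^ 2 + τ ^ 2 ≠ 0) (hH₂ : H₂ ^ 2 + τ ^ 2 ≠ 0)
    (hθ₁ : EKT.IsPhase H₁ τ θ₁) (hθ₂ : EKT.IsPhase H₂ τ θ₂)
    -- a regular curve contained in both surfaces
    (ε : ℝ) (hε : 0 < ε) (γ₁ : ℝ → S₁) (γ₂ : ℝ → S₂)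
    (hγ₁ : ContMDiffOn 𝓘(ℝ, ℝ) I₁ ∞ γ₁ (Set.Ioo (-ε) ε))
    (hγ₂ : ContMDiffOn 𝓘(ℝ, ℝ) I₂ ∞ γ₂ (Set.Ioo (-ε) ε))
    (hγ : ∀ t ∈ Set.Ioo (-ε) ε, φ₁ (γ₁ t) = φ₂ (γ₂ t))
    (hreg : ∀ t ∈ Set.Ioo (-ε) ε, EKT.velocity I₁ γ₁ t ≠ 0)
    -- the intersection is transversal along the curve
    (htrans : ∀ t ∈ Set.Ioo (-ε) ε,
      LinearMap.range (EKT.diff I₁ φ₁ (γ₁ t)).toLinearMap ⊔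
        LinearMap.range (EKT.diff I₂ φ₂ (γ₂ t)).toLinearMap = EKT.tangentE κ τ (φ₁ (γ₁ t)))
    -- condition a)
    (ha : ∃ c : ℝ, ∀ t ∈ Set.Ioo (-ε) ε,
      EKT.metric κ τ (φ₁ (γ₁ t)) (N₁ (γ₁ t)) (N₂ (γ₂ t)) = c)
    -- condition b)
    (hb : ∀ t ∈ Set.Ioo (-ε) ε,
      √(H₁ ^ 2 + τ ^ 2)
        * EKT.metric κ τ (φ₂ (γ₂ t)) (EKT.vertTanRot κ τ φ₂ N₂ θ₂ (γ₂ t)) (N₁ (γ₁ t))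
        * EKT.metric κ τ (φ₂ (γ₂ t))
            (EKT.rot κ τ φ₂ N₂ (γ₂ t) (EKT.vertTanRot κ τ φ₂ N₂ θ₂ (γ₂ t))) (N₁ (γ₁ t))
      = √(H₂ ^ 2 + τ ^ 2)
        * EKT.metric κ τ (φ₁ (γ₁ t)) (EKT.vertTanRot κ τ φ₁ N₁ θ₁ (γ₁ t)) (N₂ (γ₂ t))
        * EKT.metric κ τ (φ₁ (γ₁ t))
            (EKT.rot κ τ φ₁ N₁ (γ₁ t) (EKT.vertTanRot κ τ φ₁ N₁ θ₁ (γ₁ t))) (N₂ (γ₂ t))) :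
    EKT.IsARLine I₁ κ τ φ₁ N₁ H₁ θ₁ ε γ₁ ↔ EKT.IsARLine I₂ κ τ φ₂ N₂ H₂ θ₂ ε γ₂ := by
  have hx : Set.EqOn (φ₁ ∘ γ₁) (φ₂ ∘ γ₂) (Set.Ioo (-ε) ε) := hγ
  have hreg₁ : ∀ t ∈ Set.Ioo (-ε) ε, deriv (φ₁ ∘ γ₁) t ≠ 0 := fun t ht => by
    rw [(EKT.hasDerivAt_comp_velocity hS₁.smooth
      (hγ₁.contMDiffAt (isOpen_Ioo.mem_nhds ht))).deriv]
    exact fun h0 => hreg t ht (hS₁.immersion _ (h0.trans (map_zero _).symm))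
  have hd : ∀ t ∈ Set.Ioo (-ε) ε, deriv (φ₂ ∘ γ₂) t = deriv (φ₁ ∘ γ₁) t := fun t ht =>
    (hx.symm.eventuallyEq_of_mem (isOpen_Ioo.mem_nhds ht)).deriv_eq
  have h₁ := hS₁.isNormalAlong hγ₁ hreg₁
  have h₂ := (hS₂.isNormalAlong hγ₂ fun t ht => hd t ht ▸ hreg₁ t ht).congr hx
  rw [hS₁.isARLine_iff hγ₁, hS₂.isARLine_iff hγ₂]
  have hcongr : ∀ l : ℝ → ℝ, (∀ t ∈ Set.Ioo (-ε) ε,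
      EKT.shapeARAlong κ τ (φ₂ ∘ γ₂) (N₂ ∘ γ₂) H₂ θ₂ t = l t • deriv (φ₂ ∘ γ₂) t) ↔
      ∀ t ∈ Set.Ioo (-ε) ε,
        EKT.shapeARAlong κ τ (φ₁ ∘ γ₁) (N₂ ∘ γ₂) H₂ θ₂ t = l t • deriv (φ₁ ∘ γ₁) t := fun l =>
    forall₂_congr fun t ht => by
      rw [hd t ht, EKT.shapeARAlong_congr (hγ t ht).symm (hd t ht)]
  simp only [hcongr]
  rw [h₁.exists_eigenvalue_iff, h₂.exists_eigenvalue_iff]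
  obtain ⟨c, hc⟩ := ha
  refine forall₂_congr fun t ht => ?_
  have hc1 : c ^ 2 ≠ 1 := by
    rw [← hc t ht]
    refine EKT.sq_inn_normal_ne_one (hS₁.mem _) (hS₁.normal_mem _) (hS₁.normal_unit _)
      (h₂.normal_unit t ht) ?_ ?_ (htrans t ht)
    · rintro _ ⟨X, rfl⟩
      exact hS₁.normal_orth _ X
    · rintro _ ⟨X, rfl⟩
      rw [hγ t ht]
      exact hS₂.normal_orth _ X
  refine h₁.inn_shapeARAlong_rot_eq_zero_iff h₂ ht hH₁ hH₂ hθ₁ hθ₂ hc hc1 ?_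
  have := hb t ht
  simp only [EKT.vertTanRot, EKT.vertTan, EKT.rot, ← hγ t ht] at this
  exact this
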